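/- All rings are commutative with $1$. A \emph{real poring} is a ring $A$ with a partial ordering given by a positive cone $A^+$ (that is, $A^+ + A^+\subseteq A^+$, $A^+A^+\subseteq A^+$, $A^+\cap -A^+=\{0\}$, and $a^2\in A^+$ for all $a\in A$) which is real: $\sum a_i^2=0$ (a finite sum) implies that all $a_i=0$. An extension of real porings $A\hookrightarrow C$ is an injective ring homomorphism mapping $A^+$ into $C^+$; it is \emph{essential} if every nonzero ideal of $C$ has nonzero intersection with $A$. A real poring $C$ is \emph{real closed $*$} if every essential and integral extension of real porings $C\hookrightarrow D$ is surjective. A \emph{real closure $*$} of $A$ is an essential and integral extension of real porings $A\hookrightarrow C$ with $C$ real closed $*$. Real closures $*$ are identified when they are $A$-isomorphic, i.e. isomorphic as porings by an isomorphism compatible with the maps from $A$. Let $\operatorname{Sper} A$ be the set of prime cones $\alpha$ of $A$ with $A^+\subseteq\alpha$, i.e. subsets $\alpha\supseteq A^+$ closed under addition and multiplication, with $\alpha\cup-\alpha=A$, $-1\notin\alpha$, and $\operatorname{supp}_A(\alpha):=\alpha\cap-\alpha$ a prime ideal; for $x\in A$ let $P(x)=\{\alpha\in\operatorname{Sper}A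 : x\in\alpha\setminus\operatorname{supp}_A(\alpha)\}$. \textbf{Theorem.} Let $A$ be a real poring which is von Neumann regular (for every $a\in A$ there is $b\in A$ with $aba=a$). Then $A$ has a real closure $*$, and $A$ fails to have a unique real closure $*$ (up to $A$-isomorphism) if and only if there is an $x\in A$ such that the interior of $\operatorname{supp}_A P(x)\cap\operatorname{supp}_A P(-x)$ in $\operatorname{Spec} A$ (Zariski topology) is nonempty. -/

import Mathlib

universe u v

/-- A real poring: a commutative ring with a compatible partial order for which all squares are
nonnegative (so the positive cone is a subsemiring containing the squares and meeting its negative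
only in `0`), and which is real: a finite sum of squares vanishes only if each square root does. -/
class IsRealPoring (A : Type u) [CommRing A] [PartialOrder A] : Prop
    extends IsOrderedRing A, IsFormallyReal A where
  zero_le_sq : ∀ a : A, 0 ≤ a ^ 2

/-- Von Neumann regularity of a commutative ring. -/
def IsVonNeumannRegular (A : Type u) [CommRing A] : Prop :=
  ∀ a : A, ∃ b : A, a * b * a = a

/-- `B` is an essential extension of `A` along `f`: `f` is injective and every nonzero ideal
of `B` meets `A` nontrivially. -/
def IsEssentialExtension {A : Type u} {B : Type v} [CommRing A] [CommRing B] (f : A →+* B) : Prop :=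
  Function.Injective f ∧ ∀ I : Ideal B, I ≠ ⊥ → I.comap f ≠ ⊥

/-- A real poring is real closed `*` if it has no proper real poring extension which is both
essential and integral. (An integral extension of `C` has cardinality at most `max |C| ℵ₀`, so the
extensions in the universe of `C` suffice.) -/
def IsRealClosedStar (C : Type u) [CommRing C] [PartialOrder C] : Prop :=
  IsRealPoring C ∧
    ∀ (D : Type u) [CommRing D] [PartialOrder D] [IsRealPoring D] (g : C →+*o D),
      IsEssentialExtension (g : C →+* D) → (g : C →+* D).IsIntegral → Function.Surjective g

/-- The poring morphism `f : A → C` makes `C` a real closure `*` of `A`. -/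
structure IsRealClosureStar {A C : Type u} [CommRing A] [PartialOrder A] [CommRing C]
    [PartialOrder C] (f : A →+*o C) : Prop where
  realClosedStar : IsRealClosedStar C
  essential : IsEssentialExtension (f : A →+* C)
  integral : (f : A →+* C).IsIntegral

/-- `A`-isomorphism of two poring extensions of `A`. -/
def IsIsomorphicOver {A C D : Type u} [CommRing A] [PartialOrder A] [CommRing C] [PartialOrder C]
    [CommRing D] [PartialOrder D] (f : A →+*o C) (g : A →+*o D) : Prop :=
  ∃ e : C ≃+*o D, ∀ a : A, e (f a) = g a

/-- `A` has a real closure `*`. -/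
def HasRealClosureStar (A : Type u) [CommRing A] [PartialOrder A] : Prop :=
  ∃ (C : Type u) (_ : CommRing C) (_ : PartialOrder C) (f : A →+*o C), IsRealClosureStar f

/-- `A` has, up to `A`-isomorphism, exactly one real closure `*`. -/
def HasUniqueRealClosureStar (A : Type u) [CommRing A] [PartialOrder A] : Prop :=
  ∃ (C : Type u) (_ : CommRing C) (_ : PartialOrder C) (f : A →+*o C), IsRealClosureStar f ∧
    ∀ (D : Type u) [CommRing D] [PartialOrder D] (g : A →+*o D),
      IsRealClosureStar g → IsIsomorphicOver f g

/-- The points of the real spectrum of a poring `A`: prime cones of `A` containing the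
positive cone of `A`. -/
structure RealSpectrum (A : Type u) [CommRing A] [PartialOrder A] where
  cone : RingPreordering A
  isOrdering : cone.IsOrdering
  mem_of_nonneg : ∀ a : A, 0 ≤ a → a ∈ cone

namespace RealSpectrum

variable {A : Type u} [CommRing A] [PartialOrder A]

/-- The support `α ∩ -α` of a prime cone, as a point of the prime spectrum. -/
def supp (α : RealSpectrum A) : PrimeSpectrum A :=
  haveI := α.isOrdering
  ⟨α.cone.support, inferInstance⟩

/-- `P(x)`: the prime cones at which `x` is strictly positive. -/
def P (x : A) : Set (RealSpectrum A) :=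
  {α | x ∈ α.cone ∧ x ∉ α.supp.asIdeal}

end RealSpectrum

/-! Existence holds for every real poring. Every essential integral extension of `A` embeds in the
product of the algebraic closures of the residue fields of `A`. Zorn's lemma there, applied to pairs
(subring, positive cone), gives a maximal essential integral extension, and maximality is exactly
real closedness `*`.

For uniqueness, the key tool is a retraction. If `C` is real closed `*` and von Neumann regular, and
`R` is a reduced integral extension with a compatible positive cone, then dividing `R` by an ideal
maximal among those meeting `C` in zero makes the extension essential, hence an isomorphism; so `C`
is a retract of `R` (`IsRealClosedStar.exists_retraction`). Take for `R` the integral closure of `C`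
in a product of real closed fields over its residue fields. Roots and idempotents may then be chosen
point by point, with no continuity condition, and pushed down to `C`. Hence nonnegative elements of
`C` are squares, signs are separated by idempotents, and the residue fields of `C` are real closed.

Let two real closures `*` `C` and `D` be such that every element of `A` that is a square in `C` is a
square in `D`. Essentiality yields, for each residue field of `C`, a residue field of `D` inducing
the same ordering of `A`; uniqueness of real closures of ordered fields gives a map from `D` to that
residue field of `C`. Together these maps send `D` into the integral closure above, and the
retraction turns them into a homomorphism `D → C` over `A`, which must be bijective
(`isIsomorphicOver_of_isSquare`).

It remains to compare orderings. If `a` is a square in `C` but negative on a nonzero idempotent of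
`D`, essentiality produces a nonempty basic open set of `Spec A` over every point of which `a` is
positive for one prime cone and negative for another. Conversely, let `e` be an idempotent whose
basic open set is contained in both sets of supports for `x`. Then `A⁺ + exA⁺` and `A⁺ - exA⁺` are
both positive cones, and real closures `*` of `A` for these cones cannot be isomorphic over `A` when
`ex ≠ 0`. -/

/-! ### Von Neumann regular rings -/

namespace IsVonNeumannRegular

variable {A : Type u} {B : Type v} [CommRing A] [CommRing B]

/-- Every principal ideal is generated by an idempotent. -/
theorem exists_idempotent (hA : IsVonNeumannRegular A) (a : A) :
    ∃ b : A, a * b * (a * b) = a * b ∧ a * b * a = a := by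
  obtain ⟨b, hb⟩ := hA a
  exact ⟨b, by rw [← mul_assoc, hb], hb⟩

theorem isMaximal_of_isPrime (hA : IsVonNeumannRegular A) (p : Ideal A) [hp : p.IsPrime] :
    p.IsMaximal := by
  rw [Ideal.isMaximal_iff]
  refine ⟨fun h => hp.ne_top ((Ideal.eq_top_iff_one _).2 h), fun J x hpJ hx hxJ => ?_⟩
  obtain ⟨b, hb⟩ := hA x
  have h0 : x * (x * b - 1) ∈ p := by
    have : x * (x * b - 1) = 0 := by linear_combination hb
    rw [this]; exact p.zero_mem
  have h1 := hpJ ((hp.mem_or_mem h0).resolve_left hx)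
  have h2 : x * b ∈ J := J.mul_mem_right _ hxJ
  have := J.sub_mem h2 h1
  simpa using this

/-- The elements `a ^ k * (1 - a * b)` form a multiplicative set. If it contains `0`, then `a * (1 -
a * b)` is nilpotent, hence zero. Otherwise some prime avoids it; this prime omits `a`, yet being
maximal it contains some `1 - a * b`. -/
theorem of_forall_isMaximal [IsReduced A]
    (h : ∀ p : Ideal A, p.IsPrime → p.IsMaximal) : IsVonNeumannRegular A := by
  intro a
  let S : Submonoid A :=
    { carrier := {s | ∃ (k : ℕ) (b : A), s = a ^ k * (1 - a * b)}
      one_mem' := ⟨0, 0, by simp⟩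
      mul_mem' := by
        rintro _ _ ⟨k, b, rfl⟩ ⟨l, c, rfl⟩
        exact ⟨k + l, b + c - a * b * c, by ring⟩ }
  by_cases h0 : (0 : A) ∈ S
  · obtain ⟨k, b, hk⟩ := h0
    refine ⟨b, ?_⟩
    have h1 : (a * (1 - a * b)) ^ (k + 1) = 0 := by
      have : (a * (1 - a * b)) ^ (k + 1) =
          (a ^ k * (1 - a * b)) * (a * (1 - a * b) ^ k) := by
        rw [mul_pow]; ring
      rw [this, ← hk, zero_mul]
    have h2 : a * (1 - a * b) = 0 := eq_zero_of_pow_eq_zero h1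
    linear_combination -h2
  · exfalso
    have hdisj : Disjoint ((⊥ : Ideal A) : Set A) S := by
      rw [Set.disjoint_left]
      rintro x hx hxS
      rw [SetLike.mem_coe, Ideal.mem_bot] at hx
      exact h0 (hx ▸ hxS)
    obtain ⟨p, hp, -, hpS⟩ := Ideal.exists_le_prime_disjoint ⊥ S hdisj
    rw [Set.disjoint_left] at hpS
    have ha : a ∉ p := fun ha => hpS ha ⟨1, 0, by simp⟩
    obtain ⟨b, i, hi, hb⟩ := (h p hp).exists_inv ha
    exact hpS hi ⟨0, b, by simp only [pow_zero, one_mul]; linear_combination hb⟩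

theorem of_isIntegral [IsReduced B] (hA : IsVonNeumannRegular A) {f : A →+* B}
    (hf : f.IsIntegral) : IsVonNeumannRegular B :=
  of_forall_isMaximal fun p _ =>
    Ideal.isMaximal_of_isIntegral_of_isMaximal_comap' f hf p
      (hA.isMaximal_of_isPrime (p.comap f))

theorem isReduced (hA : IsVonNeumannRegular A) : IsReduced A := by
  rw [isReduced_iff_pow_one_lt 2 (by lia)]
  intro x hx
  obtain ⟨b, hb⟩ := hA x
  rw [← hb]
  linear_combination b * hx

theorem of_surjective (hA : IsVonNeumannRegular A) {f : A →+* B}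
    (hf : Function.Surjective f) : IsVonNeumannRegular B := by
  intro x
  obtain ⟨a, rfl⟩ := hf x
  obtain ⟨b, hb⟩ := hA a
  exact ⟨f b, by rw [← map_mul, ← map_mul, hb]⟩

end IsVonNeumannRegular

/-! ### Positive cones -/

/-- The positive cone of a partial ordering of a ring in which squares are nonnegative. -/
structure IsPositiveCone {R : Type u} [CommRing R] (P : Set R) : Prop where
  add_mem : ∀ {a b}, a ∈ P → b ∈ P → a + b ∈ P
  mul_mem : ∀ {a b}, a ∈ P → b ∈ P → a * b ∈ P
  mul_self_mem : ∀ a, a * a ∈ P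
  eq_zero : ∀ {a}, a ∈ P → -a ∈ P → a = 0

namespace IsPositiveCone

variable {R : Type u} [CommRing R] {P : Set R}

theorem zero_mem (h : IsPositiveCone P) : (0 : R) ∈ P := by simpa using h.mul_self_mem 0

theorem one_mem (h : IsPositiveCone P) : (1 : R) ∈ P := by simpa using h.mul_self_mem 1

/-- The partial order with a given positive cone. -/
abbrev partialOrder (h : IsPositiveCone P) : PartialOrder R where
  le a b := b - a ∈ P
  le_refl a := by simpa using h.zero_mem
  le_trans a b c hab hbc := by simpa using h.add_mem hbc hab
  le_antisymm a b hab hba := by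
    have := h.eq_zero hab (by simpa using hba)
    exact (sub_eq_zero.1 this).symm

theorem nonneg_iff (h : IsPositiveCone P) {a : R} : h.partialOrder.le 0 a ↔ a ∈ P := by
  change a - 0 ∈ P ↔ _
  rw [sub_zero]

theorem mem_of_isSumSq (h : IsPositiveCone P) {a : R} (ha : IsSumSq a) : a ∈ P := by
  induction ha with
  | zero => exact h.zero_mem
  | sq_add a _ ih => exact h.add_mem (h.mul_self_mem a) ih

theorem isRealPoring [IsReduced R] (h : IsPositiveCone P) :
    @IsRealPoring R _ h.partialOrder := by
  let := h.partialOrder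
  have key : ∀ a b : R, a ≤ b ↔ b - a ∈ P := fun _ _ => Iff.rfl
  have hmul : ∀ a b c : R, 0 ≤ c → a ≤ b → c * a ≤ c * b := by
    intro a b c hc hab
    rw [key] at *
    rw [← mul_sub]
    exact h.mul_mem (by simpa using hc) hab
  have hreal : IsFormallyReal R :=
    .of_eq_zero_of_mul_self_of_eq_zero_of_add (fun {a} ha => by
      exact eq_zero_of_pow_eq_zero (n := 2) (by rw [pow_two, ha]))
      (fun h1 h2 h12 => h.eq_zero (h.mem_of_isSumSq h1)
        (by rw [← eq_neg_of_add_eq_zero_right h12]; exact h.mem_of_isSumSq h2))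
  exact
    { add_le_add_left := fun a b hab c => by
        rw [key] at *; simpa using hab
      zero_le_one := by rw [key, sub_zero]; exact h.one_mem
      mul_le_mul_of_nonneg_left := fun c hc a b hab => hmul a b c hc hab
      mul_le_mul_of_nonneg_right := fun c hc a b hab => by
        rw [mul_comm a, mul_comm b]; exact hmul a b c hc hab
      not_isSumNonzeroSq_zero := hreal.not_isSumNonzeroSq_zero
      zero_le_sq := fun a => by rw [key, sub_zero, pow_two]; exact h.mul_self_mem a }

end IsPositiveCone

theorem isPositiveCone_nonneg (R : Type u) [CommRing R] [PartialOrder R] [IsRealPoring R] :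
    IsPositiveCone {a : R | 0 ≤ a} where
  add_mem := fun {_ _} ha hb => add_nonneg ha hb
  mul_mem := fun {_ _} ha hb => mul_nonneg ha hb
  mul_self_mem := fun a => by
    have := IsRealPoring.zero_le_sq a
    rwa [pow_two] at this
  eq_zero := fun {a} ha hb => le_antisymm (neg_nonneg.1 hb) ha

/-- A ring homomorphism mapping nonnegative elements to nonnegative elements, as a morphism of
ordered rings. -/
def RingHom.toOrderRingHom {A : Type u} {B : Type v} [CommRing A] [PartialOrder A]
    [IsOrderedRing A] [CommRing B] [PartialOrder B] [IsOrderedRing B] (f : A →+* B)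
    (hf : ∀ a, 0 ≤ a → 0 ≤ f a) : A →+*o B where
  __ := f
  monotone' a b hab := by
    have := hf (b - a) (sub_nonneg.2 hab)
    rw [map_sub] at this
    exact sub_nonneg.1 this

/-- Essentiality, elementwise. -/
theorem isEssentialExtension_iff {A : Type u} {B : Type v} [CommRing A] [CommRing B]
    (f : A →+* B) : IsEssentialExtension f ↔ Function.Injective f ∧
      ∀ b : B, b ≠ 0 → ∃ c : B, ∃ a : A, a ≠ 0 ∧ c * b = f a := by
  refine and_congr_right fun hf => ⟨fun h b hb => ?_, fun h I hI => ?_⟩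
  · have h1 := h (Ideal.span {b}) (by simpa using hb)
    obtain ⟨a, ha, ha0⟩ := Submodule.exists_mem_ne_zero_of_ne_bot h1
    rw [Ideal.mem_comap, Ideal.mem_span_singleton'] at ha
    obtain ⟨c, hc⟩ := ha
    exact ⟨c, a, ha0, hc⟩
  · obtain ⟨b, hb, hb0⟩ := Submodule.exists_mem_ne_zero_of_ne_bot hI
    obtain ⟨c, a, ha, hca⟩ := h b hb0
    intro hbot
    refine ha ?_
    have : a ∈ I.comap f := by
      rw [Ideal.mem_comap, ← hca]; exact I.mul_mem_left _ hb
    rwa [hbot, Ideal.mem_bot] at this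

/-! ### Existence of real closures `*` -/

/-- Extension of homomorphisms into algebraically closed fields along integral extensions. -/
theorem RingHom.IsIntegral.exists_comp_eq {C D Ω : Type u} [CommRing C] [CommRing D] [Field Ω]
    [IsAlgClosed Ω] {g : C →+* D} (hg : g.IsIntegral) (hinj : Function.Injective g)
    (φ : C →+* Ω) : ∃ ψ : D →+* Ω, ψ.comp g = φ := by
  let : Algebra C D := g.toAlgebra
  have : Algebra.IsIntegral C D := ⟨hg⟩
  have : (RingHom.ker φ).IsPrime := RingHom.ker_isPrime φ
  -- Lying over reduces the claim to the integral extension of domains `C ⧸ ker φ → D ⧸ Q`, where a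
  -- lift to an algebraically closed field exists.
  obtain ⟨Q, -, hQ, hQP⟩ := Ideal.exists_ideal_over_prime_of_isIntegral (S := D)
    (RingHom.ker φ) ⊥ (by
      intro x hx
      have : x = 0 := hinj ((show g x = 0 from hx).trans (map_zero g).symm)
      simp [this])
  have hker : ∀ c, g c ∈ Q ↔ φ c = 0 := fun c => by
    rw [← RingHom.mem_ker, ← hQP]; rfl
  let f₁ : C ⧸ RingHom.ker φ →+* D ⧸ Q :=
    Ideal.quotientMap Q g (fun c hc => (hker c).2 hc)
  let f₂ : C ⧸ RingHom.ker φ →+* Ω := RingHom.kerLift φ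
  let : Algebra (C ⧸ RingHom.ker φ) (D ⧸ Q) := f₁.toAlgebra
  let : Algebra (C ⧸ RingHom.ker φ) Ω := f₂.toAlgebra
  have hf₁ : Function.Injective f₁ := Ideal.quotientMap_injective' (fun c hc => (hker c).1 hc)
  have hf₂ : Function.Injective f₂ := RingHom.kerLift_injective φ
  have : IsDomain (C ⧸ RingHom.ker φ) := Ideal.Quotient.isDomain _
  have : IsDomain (D ⧸ Q) := Ideal.Quotient.isDomain _
  have : Module.IsTorsionFree (C ⧸ RingHom.ker φ) (D ⧸ Q) :=
    Module.isTorsionFree_iff_algebraMap_injective.2 hf₁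
  have : Module.IsTorsionFree (C ⧸ RingHom.ker φ) Ω :=
    Module.isTorsionFree_iff_algebraMap_injective.2 hf₂
  have : Algebra.IsIntegral (C ⧸ RingHom.ker φ) (D ⧸ Q) := ⟨by
    have h1 : (f₁.comp (Ideal.Quotient.mk _)).IsIntegral := by
      have : f₁.comp (Ideal.Quotient.mk _) = (Ideal.Quotient.mk Q).comp g :=
        Ideal.quotientMap_comp_mk _
      rw [this]
      exact hg.trans _ _ (RingHom.isIntegral_of_surjective _ Ideal.Quotient.mk_surjective)
    exact h1.tower_top⟩
  let l : D ⧸ Q →ₐ[C ⧸ RingHom.ker φ] Ω := IsAlgClosed.lift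
  refine ⟨(l : D ⧸ Q →+* Ω).comp (Ideal.Quotient.mk Q), ?_⟩
  ext c
  have := l.commutes (Ideal.Quotient.mk _ c)
  exact this

/-! ### Maximal essential integral extensions inside a fixed ring -/

section Zorn

variable {A : Type u} {M : Type u} [CommRing A] [PartialOrder A] [CommRing M]

/-- A subring `S` of an extension `M` of the poring `A`, together with a positive cone of `S`,
forming an essential and integral extension of porings. -/
structure IsPoringExtensionIn (j : A →+* M) (x : Subring M × Set M) : Prop where
  map_mem : ∀ a, j a ∈ x.1
  subset : ∀ s ∈ x.2, s ∈ x.1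
  map_nonneg : ∀ a, 0 ≤ a → j a ∈ x.2
  add_mem : ∀ s t, s ∈ x.2 → t ∈ x.2 → s + t ∈ x.2
  mul_mem : ∀ s t, s ∈ x.2 → t ∈ x.2 → s * t ∈ x.2
  mul_self_mem : ∀ s ∈ x.1, s * s ∈ x.2
  eq_zero : ∀ s, s ∈ x.2 → -s ∈ x.2 → s = 0
  integral : ∀ s ∈ x.1, j.IsIntegralElem s
  essential : ∀ s ∈ x.1, s ≠ 0 → ∃ t ∈ x.1, ∃ a, a ≠ 0 ∧ t * s = j a

variable (j : A →+* M)

theorem isPoringExtensionIn_range [IsRealPoring A] (hj : Function.Injective j) :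
    IsPoringExtensionIn j (j.range, j '' {a | 0 ≤ a}) where
  map_mem a := ⟨a, rfl⟩
  subset := by rintro _ ⟨a, -, rfl⟩; exact ⟨a, rfl⟩
  map_nonneg a ha := ⟨a, ha, rfl⟩
  add_mem := by
    rintro _ _ ⟨a, ha, rfl⟩ ⟨b, hb, rfl⟩
    exact ⟨a + b, add_nonneg ha hb, map_add _ _ _⟩
  mul_mem := by
    rintro _ _ ⟨a, ha, rfl⟩ ⟨b, hb, rfl⟩
    exact ⟨a * b, mul_nonneg ha hb, map_mul _ _ _⟩
  mul_self_mem := by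
    rintro _ ⟨a, rfl⟩
    exact ⟨a * a, (isPositiveCone_nonneg A).mul_self_mem a, map_mul _ _ _⟩
  eq_zero := by
    rintro _ ⟨a, ha, rfl⟩ ⟨b, hb, hab⟩
    rw [← map_neg] at hab
    rw [hj hab] at hb
    rw [(isPositiveCone_nonneg A).eq_zero ha hb, map_zero]
  integral := by
    rintro _ ⟨a, rfl⟩
    exact j.isIntegralElem_map
  essential := by
    rintro _ ⟨a, rfl⟩ ha
    exact ⟨1, ⟨1, map_one _⟩, a, fun h => ha (by rw [h, map_zero]), one_mul _⟩

/-- Each condition involves finitely many elements at a time, so it passes to unions of chains. -/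
theorem exists_maximal_isPoringExtensionIn [IsRealPoring A] (hj : Function.Injective j) :
    ∃ m, Maximal (IsPoringExtensionIn j) m := by
  suffices h : ∀ c ⊆ {x | IsPoringExtensionIn j x}, IsChain (· ≤ ·) c → ∀ y ∈ c,
      ∃ ub ∈ {x | IsPoringExtensionIn j x}, ∀ z ∈ c, z ≤ ub from
    (zorn_le_nonempty₀ _ h _ (isPoringExtensionIn_range j hj)).imp fun _ hm => hm.2
  intro c hc hchain y hy
  have hdir : DirectedOn (· ≤ ·) c := hchain.directedOn
  have hdir1 : DirectedOn (· ≤ ·) (Prod.fst '' c) := by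
    rintro _ ⟨x, hx, rfl⟩ _ ⟨y, hy, rfl⟩
    obtain ⟨z, hz, hxz, hyz⟩ := hdir x hx y hy
    exact ⟨z.1, ⟨z, hz, rfl⟩, hxz.1, hyz.1⟩
  have hS : ∀ s, s ∈ sSup (Prod.fst '' c) ↔ ∃ x ∈ c, s ∈ x.1 := fun s => by
    rw [Subring.mem_sSup_of_directedOn (Set.Nonempty.image _ ⟨y, hy⟩) hdir1]
    simp
  have hP : ∀ s, s ∈ (⋃ x ∈ c, x.2) ↔ ∃ x ∈ c, s ∈ x.2 := fun s => by simp
  have h2 : ∀ s t, (∃ x ∈ c, s ∈ x.2) → (∃ x ∈ c, t ∈ x.2) →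
      ∃ x ∈ c, s ∈ x.2 ∧ t ∈ x.2 := by
    rintro s t ⟨x, hx, hs⟩ ⟨y, hy, ht⟩
    obtain ⟨z, hz, hxz, hyz⟩ := hdir x hx y hy
    exact ⟨z, hz, hxz.2 hs, hyz.2 ht⟩
  refine ⟨(sSup (Prod.fst '' c), ⋃ x ∈ c, x.2), ?_, fun z hz => ⟨?_, ?_⟩⟩
  · constructor
    · exact fun a => (hS _).2 ⟨y, hy, (hc hy).map_mem a⟩
    · intro s hs
      obtain ⟨x, hx, hs⟩ := (hP s).1 hs
      exact (hS _).2 ⟨x, hx, (hc hx).subset s hs⟩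
    · exact fun a ha => (hP _).2 ⟨y, hy, (hc hy).map_nonneg a ha⟩
    · intro s t hs ht
      obtain ⟨x, hx, hs, ht⟩ := h2 s t ((hP s).1 hs) ((hP t).1 ht)
      exact (hP _).2 ⟨x, hx, (hc hx).add_mem s t hs ht⟩
    · intro s t hs ht
      obtain ⟨x, hx, hs, ht⟩ := h2 s t ((hP s).1 hs) ((hP t).1 ht)
      exact (hP _).2 ⟨x, hx, (hc hx).mul_mem s t hs ht⟩
    · intro s hs
      obtain ⟨x, hx, hs⟩ := (hS s).1 hs
      exact (hP _).2 ⟨x, hx, (hc hx).mul_self_mem s hs⟩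
    · intro s hs ht
      obtain ⟨x, hx, hs, ht⟩ := h2 s (-s) ((hP s).1 hs) ((hP _).1 ht)
      exact (hc hx).eq_zero s hs ht
    · intro s hs
      obtain ⟨x, hx, hs⟩ := (hS s).1 hs
      exact (hc hx).integral s hs
    · intro s hs hs0
      obtain ⟨x, hx, hs⟩ := (hS s).1 hs
      obtain ⟨t, ht, a, ha, hta⟩ := (hc hx).essential s hs hs0
      exact ⟨t, (hS t).2 ⟨x, hx, ht⟩, a, ha, hta⟩
  · exact fun s hs => (hS s).2 ⟨z, hz, hs⟩
  · exact fun s hs => (hP s).2 ⟨z, hz, hs⟩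

end Zorn

/-- Every real poring has a real closure `*`. -/
theorem hasRealClosureStar (A : Type u) [CommRing A] [PartialOrder A] [IsRealPoring A] :
    HasRealClosureStar A := by
  -- An ambient ring that receives every essential integral extension of each of its subrings
  -- integral over `A`: homomorphisms extend coordinatewise into algebraically closed fields.
  let M := ∀ p : PrimeSpectrum A, AlgebraicClosure (FractionRing (A ⧸ p.asIdeal))
  let j : A →+* M := RingHom.pi fun p => ((algebraMap (FractionRing (A ⧸ p.asIdeal))
    (AlgebraicClosure (FractionRing (A ⧸ p.asIdeal)))).comp (algebraMap (A ⧸ p.asIdeal)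
      (FractionRing (A ⧸ p.asIdeal)))).comp (Ideal.Quotient.mk p.asIdeal)
  have hj : Function.Injective j := by
    rw [injective_iff_map_eq_zero]
    intro a ha
    have h1 : ∀ p : PrimeSpectrum A, a ∈ p.asIdeal := fun p => by
      have := congrFun ha p
      rw [← Ideal.Quotient.eq_zero_iff_mem]
      apply IsFractionRing.injective (A ⧸ p.asIdeal) (FractionRing (A ⧸ p.asIdeal))
      apply FaithfulSMul.algebraMap_injective (FractionRing (A ⧸ p.asIdeal))
        (AlgebraicClosure (FractionRing (A ⧸ p.asIdeal)))
      rw [map_zero, map_zero]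
      exact this
    have h2 : a ∈ nilradical A := nilpotent_iff_mem_prime.2 fun J hJ => h1 ⟨J, hJ⟩
    rwa [nilradical_eq_zero, Ideal.zero_eq_bot, Ideal.mem_bot] at h2
  obtain ⟨⟨S, P⟩, hm⟩ := exists_maximal_isPoringExtensionIn j hj
  have hSP := hm.prop
  have : IsReduced M := inferInstance
  have hcone : IsPositiveCone {s : S | (s : M) ∈ P} :=
    { add_mem := fun {a b} ha hb => hSP.add_mem _ _ ha hb
      mul_mem := fun {a b} ha hb => hSP.mul_mem _ _ ha hb
      mul_self_mem := fun a => hSP.mul_self_mem _ a.2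
      eq_zero := fun {a} ha hb => Subtype.ext (hSP.eq_zero _ ha hb) }
  have hSred : IsReduced S := isReduced_of_injective S.subtype S.subtype_injective
  let oS : PartialOrder S := hcone.partialOrder
  have hSreal : IsRealPoring S := hcone.isRealPoring
  have hnn : ∀ s : S, 0 ≤ s ↔ (s : M) ∈ P := fun s => hcone.nonneg_iff
  let f₀ : A →+* S := j.codRestrict S hSP.map_mem
  have hf₀ : S.subtype.comp f₀ = j := rfl
  let f : A →+*o S := f₀.toOrderRingHom fun a ha => (hnn _).2 (hSP.map_nonneg a ha)
  have hfess : IsEssentialExtension (f : A →+* S) := by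
    rw [isEssentialExtension_iff]
    refine ⟨fun a b hab => hj (congrArg Subtype.val hab), fun s hs => ?_⟩
    obtain ⟨t, ht, a, ha, hta⟩ := hSP.essential s s.2 (fun h => hs (Subtype.ext h))
    exact ⟨⟨t, ht⟩, a, ha, Subtype.ext hta⟩
  have hfint : (f : A →+* S).IsIntegral := by
    intro s
    obtain ⟨p, hp, hps⟩ := hSP.integral s s.2
    refine ⟨p, hp, Subtype.ext ?_⟩
    rw [← hf₀, ← S.coe_subtype, ← Polynomial.hom_eval₂] at hps
    exact hps
  refine ⟨S, inferInstance, oS, f, ⟨hSreal, ?_⟩, hfess, hfint⟩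
  intro D _ _ _ g hgess hgint
  obtain ⟨ψ, hψ⟩ : ∃ ψ : D →+* M, ψ.comp (g : S →+* D) = S.subtype := by
    choose ψ hψ using fun p : PrimeSpectrum A => hgint.exists_comp_eq hgess.1
      ((Pi.evalRingHom _ p).comp S.subtype)
    refine ⟨RingHom.pi ψ, RingHom.ext fun s => funext fun p => ?_⟩
    exact congrArg (fun h : S →+* _ => h s) (hψ p)
  have hψg : ∀ s : S, ψ (g s) = s := fun s => congrArg (fun h : S →+* M => h s) hψ
  -- The kernel of `ψ` meets `S` in zero, so essentiality of `D` over `S` kills it.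
  have hψinj : Function.Injective ψ := by
    rw [RingHom.injective_iff_ker_eq_bot]
    by_contra hne
    refine hgess.2 _ hne ?_
    rw [eq_bot_iff]
    intro s hs
    have : ψ (g s) = 0 := hs
    rw [hψg] at this
    exact (Subtype.ext this : s = 0)
  have hψf : ∀ a, ψ (g (f a)) = j a := fun a => hψg _
  have hgood : IsPoringExtensionIn j (ψ.range, ψ '' {d | 0 ≤ d}) := by
    have hr := isPoringExtensionIn_range ψ hψinj
    refine ⟨fun a => ⟨_, hψf a⟩, hr.subset, fun a ha => ⟨g (f a), ?_, hψf a⟩, hr.add_mem,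
      hr.mul_mem, hr.mul_self_mem, hr.eq_zero, ?_, ?_⟩
    · have h1 : (0 : S) ≤ f a := by simpa using f.monotone' ha
      simpa using g.monotone' h1
    · rintro _ ⟨d, rfl⟩
      have h1 : ((g : S →+* D).comp (f : A →+* S)).IsIntegral := hfint.trans _ _ hgint
      obtain ⟨p, hp, hpd⟩ := h1 d
      refine ⟨p, hp, ?_⟩
      have h2 : j = ψ.comp ((g : S →+* D).comp (f : A →+* S)) :=
        RingHom.ext fun a => (hψf a).symm
      rw [h2, ← Polynomial.hom_eval₂, hpd, map_zero]
    · rintro _ ⟨d, rfl⟩ hd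
      have hd0 : d ≠ 0 := fun h => hd (by rw [h, map_zero])
      obtain ⟨c, s, hs, hcs⟩ := ((isEssentialExtension_iff _).1 hgess).2 d hd0
      obtain ⟨t, a, ha, hta⟩ := ((isEssentialExtension_iff _).1 hfess).2 s hs
      refine ⟨ψ (g t * c), ⟨_, rfl⟩, a, ha, ?_⟩
      rw [← map_mul, mul_assoc, hcs, ← hψf]
      congr 1
      exact (map_mul g t s).symm.trans (congrArg g hta)
  -- The image of `D` with its cone dominates the maximal pair, so it lies in `S`; this makes `g`
  -- surjective.
  have hle := hm.le_of_ge hgood ⟨fun s hs => ⟨g ⟨s, hs⟩, hψg ⟨s, hs⟩⟩, fun s hs =>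
    ⟨g ⟨s, hSP.subset s hs⟩, by simpa using g.monotone' ((hnn ⟨s, hSP.subset s hs⟩).2 hs),
      hψg _⟩⟩
  intro d
  have hd : ψ d ∈ S := hle.1 ⟨d, rfl⟩
  exact ⟨⟨ψ d, hd⟩, hψinj (hψg _)⟩

/-! ### Retractions onto real closed `*` rings -/

/-- Von Neumann regularity makes every ideal convex. If `s, t ∈ P` and `s + t ∈ J`, let `e` be the
idempotent `1 - (s + t) * b` annihilating `s + t`. Then `e * s = -(e * t)` forces `e * s = 0`, so
`s` is a multiple of `s + t`. -/
theorem IsPositiveCone.image_quotientMk {R : Type u} [CommRing R] {P : Set R}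
    (hP : IsPositiveCone P) (hR : IsVonNeumannRegular R) (J : Ideal R) :
    IsPositiveCone (Ideal.Quotient.mk J '' P) where
  add_mem := by
    rintro _ _ ⟨a, ha, rfl⟩ ⟨b, hb, rfl⟩
    exact ⟨a + b, hP.add_mem ha hb, map_add _ _ _⟩
  mul_mem := by
    rintro _ _ ⟨a, ha, rfl⟩ ⟨b, hb, rfl⟩
    exact ⟨a * b, hP.mul_mem ha hb, map_mul _ _ _⟩
  mul_self_mem a := by
    obtain ⟨a, rfl⟩ := Ideal.Quotient.mk_surjective a
    exact ⟨a * a, hP.mul_self_mem a, map_mul _ _ _⟩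
  eq_zero := by
    rintro _ ⟨s, hs, rfl⟩ ⟨t, ht, hst⟩
    have hw : s + t ∈ J := by
      rw [← Ideal.Quotient.eq_zero_iff_mem, map_add, hst, add_neg_cancel]
    obtain ⟨b, h1, h2⟩ := hR.exists_idempotent (s + t)
    have hmem : (1 - (s + t) * b) ∈ P := by
      have := hP.mul_self_mem (1 - (s + t) * b)
      convert this using 1
      linear_combination -h1
    have h3 : (1 - (s + t) * b) * s = 0 := by
      refine hP.eq_zero (hP.mul_mem hmem hs) ?_
      have := hP.mul_mem hmem ht
      convert this using 1
      linear_combination h2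
    rw [Ideal.Quotient.eq_zero_iff_mem]
    have h4 : s = (s + t) * (b * s) := by linear_combination h3
    rw [h4]
    exact J.mul_mem_right _ hw

/-- An injective homomorphism becomes essential modulo a suitable ideal. -/
theorem exists_isEssentialExtension_quotientMk_comp {A R : Type u} [CommRing A] [CommRing R]
    (f : A →+* R) (hf : Function.Injective f) :
    ∃ J : Ideal R, IsEssentialExtension ((Ideal.Quotient.mk J).comp f) := by
  have hbot : (⊥ : Ideal R).comap f = ⊥ := by
    rw [← RingHom.ker_eq_comap_bot]; exact (RingHom.injective_iff_ker_eq_bot f).1 hf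
  -- A nonzero ideal of `R ⧸ J` meeting `A` in zero would pull back to a strictly larger ideal of
  -- this kind.
  obtain ⟨J, -, hJ⟩ : ∃ J : Ideal R, ⊥ ≤ J ∧ Maximal (· ∈ {J : Ideal R | J.comap f = ⊥}) J := by
    refine zorn_le_nonempty₀ _ (fun c hc hchain y hy => ?_) ⊥ hbot
    refine ⟨sSup c, ?_, fun z hz => le_sSup hz⟩
    change Ideal.comap f (sSup c) = ⊥
    rw [eq_bot_iff]
    intro a ha
    rw [Ideal.mem_comap, Submodule.mem_sSup_of_directed ⟨y, hy⟩ hchain.directedOn] at ha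
    obtain ⟨I, hI, ha⟩ := ha
    have : a ∈ Ideal.comap f I := ha
    rwa [show Ideal.comap f I = ⊥ from hc hI] at this
  refine ⟨J, ?_, fun I hI h0 => ?_⟩
  · rw [RingHom.injective_iff_ker_eq_bot, RingHom.ker_eq_comap_bot, ← Ideal.comap_comap,
      ← RingHom.ker_eq_comap_bot, Ideal.mk_ker]
    exact hJ.prop
  · rw [← Ideal.comap_comap] at h0
    have hle : J ≤ I.comap (Ideal.Quotient.mk J) := fun x hx => by
      rw [Ideal.mem_comap, Ideal.Quotient.eq_zero_iff_mem.2 hx]; exact I.zero_mem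
    have h1 := hJ.le_of_ge h0 hle
    refine hI ?_
    rw [eq_bot_iff]
    intro x hx
    obtain ⟨x, rfl⟩ := Ideal.Quotient.mk_surjective x
    exact Ideal.Quotient.eq_zero_iff_mem.2 (h1 hx)

/-- Modulo a suitable ideal `J`, the extension becomes essential while the cone survives because `R`
is von Neumann regular. Real closedness `*` then identifies `C` with `R ⧸ J`. -/
theorem IsRealClosedStar.exists_retraction {C R : Type u} [CommRing C] [PartialOrder C]
    (hC : IsRealClosedStar C) (hCr : IsVonNeumannRegular C) [CommRing R] [IsReduced R]
    {P : Set R} (hP : IsPositiveCone P) (f : C →+* R) (hinj : Function.Injective f)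
    (hnn : ∀ c, 0 ≤ c → f c ∈ P) (hintegral : f.IsIntegral) :
    ∃ r : R →+* C, ∀ c, r (f c) = c := by
  have := hC.1
  have hR : IsVonNeumannRegular R := hCr.of_isIntegral hintegral
  obtain ⟨J, hJ⟩ := exists_isEssentialExtension_quotientMk_comp f hinj
  have hQ := hP.image_quotientMk hR J
  have hred : IsReduced (R ⧸ J) :=
    (hR.of_surjective (Ideal.Quotient.mk_surjective (I := J))).isReduced
  let : PartialOrder (R ⧸ J) := hQ.partialOrder
  have : IsRealPoring (R ⧸ J) := hQ.isRealPoring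
  let g : C →+*o R ⧸ J := ((Ideal.Quotient.mk J).comp f).toOrderRingHom
    fun c hc => hQ.nonneg_iff.2 ⟨f c, hnn c hc, rfl⟩
  have hsurj := hC.2 (R ⧸ J) g hJ
    (hintegral.trans _ _ (RingHom.isIntegral_of_surjective _ Ideal.Quotient.mk_surjective))
  let e : C ≃+* R ⧸ J := RingEquiv.ofBijective ((Ideal.Quotient.mk J).comp f) ⟨hJ.1, hsurj⟩
  exact ⟨(e.symm : R ⧸ J →+* C).comp (Ideal.Quotient.mk J), fun c => e.symm_apply_apply c⟩

/-! ### Real closed fields and the intermediate value property -/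

open Polynomial in
/-- A real closed field, characterized by the intermediate value property: the squares form the
positive cone of a total ordering for which polynomials have the intermediate value property. -/
class IsIVTField (R : Type u) [Field R] : Prop where
  isSquare_add : ∀ {x y : R}, IsSquare x → IsSquare y → IsSquare (x + y)
  not_isSquare_neg_one : ¬ IsSquare (-1 : R)
  isSquare_or_isSquare_neg : ∀ x : R, IsSquare x ∨ IsSquare (-x)
  exists_root : ∀ (f : R[X]) (a b : R), IsSquare (-(f.eval a * f.eval b)) →
    ∃ c, f.eval c = 0 ∧ IsSquare ((c - a) * (b - c))

namespace IsPositiveCone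

variable {K : Type u} [Field K] {P : Set K}

theorem of_neg_one_notMem (hadd : ∀ {a b}, a ∈ P → b ∈ P → a + b ∈ P)
    (hmul : ∀ {a b}, a ∈ P → b ∈ P → a * b ∈ P) (hsq : ∀ a, a * a ∈ P) (hneg : (-1 : K) ∉ P) :
    IsPositiveCone P where
  add_mem := hadd
  mul_mem := hmul
  mul_self_mem := hsq
  eq_zero := fun {a} ha hna => by
    by_contra h0
    refine hneg ?_
    have := hmul (hmul ha hna) (hsq a⁻¹)
    convert this using 1
    field_simp

theorem neg_one_notMem (hP : IsPositiveCone P) : (-1 : K) ∉ P := fun h =>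
  one_ne_zero (hP.eq_zero hP.one_mem h)

/-- Adjoining `-x` to a positive cone of a field which does not contain `x`. -/
theorem adjoin_neg (hP : IsPositiveCone P) {x : K} (hx : x ∉ P) :
    IsPositiveCone {z | ∃ s ∈ P, ∃ t ∈ P, z = s - x * t} := by
  refine of_neg_one_notMem ?_ ?_ ?_ ?_
  · rintro _ _ ⟨s, hs, t, ht, rfl⟩ ⟨s', hs', t', ht', rfl⟩
    exact ⟨s + s', hP.add_mem hs hs', t + t', hP.add_mem ht ht', by ring⟩
  · rintro _ _ ⟨s, hs, t, ht, rfl⟩ ⟨s', hs', t', ht', rfl⟩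
    exact ⟨s * s' + x * x * (t * t'), hP.add_mem (hP.mul_mem hs hs')
      (hP.mul_mem (hP.mul_self_mem x) (hP.mul_mem ht ht')), s * t' + t * s',
      hP.add_mem (hP.mul_mem hs ht') (hP.mul_mem ht hs'), by ring⟩
  · exact fun a => ⟨a * a, hP.mul_self_mem a, 0, hP.zero_mem, by ring⟩
  · rintro ⟨s, hs, t, ht, h⟩
    by_cases h0 : t = 0
    · refine hP.neg_one_notMem ?_
      rw [h, h0, mul_zero, sub_zero]; exact hs
    · refine hx ?_
      -- Solving `-1 = s - x * t` gives `x = (1 + s) * t * (t⁻¹ * t⁻¹)`, an element of `P`.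
      have := hP.mul_mem (hP.mul_mem (hP.add_mem hP.one_mem hs) ht) (hP.mul_self_mem t⁻¹)
      convert this using 1
      field_simp
      linear_combination h

/-- A cone maximal for inclusion that omits `x` contains `-x`, since `-x` can be adjoined. -/
theorem exists_total (hP : IsPositiveCone P) :
    ∃ Q, P ⊆ Q ∧ IsPositiveCone Q ∧ ∀ x, x ∈ Q ∨ -x ∈ Q := by
  obtain ⟨Q, hPQ, hQ⟩ : ∃ Q, P ⊆ Q ∧ Maximal (· ∈ {Q : Set K | IsPositiveCone Q}) Q := by
    refine zorn_subset_nonempty _ (fun c hc hchain hne => ?_) P hP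
    obtain ⟨y, hy⟩ := hne
    have h2 : ∀ {s t}, s ∈ ⋃₀ c → t ∈ ⋃₀ c → ∃ x ∈ c, s ∈ x ∧ t ∈ x := by
      rintro s t ⟨x, hx, hs⟩ ⟨y, hy, ht⟩
      obtain ⟨z, hz, hxz, hyz⟩ := hchain.directedOn x hx y hy
      exact ⟨z, hz, hxz hs, hyz ht⟩
    refine ⟨⋃₀ c, ?_, fun s hs => Set.subset_sUnion_of_mem hs⟩
    constructor
    · intro a b ha hb
      obtain ⟨x, hx, ha, hb⟩ := h2 ha hb
      exact ⟨x, hx, (hc hx).add_mem ha hb⟩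
    · intro a b ha hb
      obtain ⟨x, hx, ha, hb⟩ := h2 ha hb
      exact ⟨x, hx, (hc hx).mul_mem ha hb⟩
    · exact fun a => ⟨y, hy, (hc hy).mul_self_mem a⟩
    · intro a ha hb
      obtain ⟨x, hx, ha, hb⟩ := h2 ha hb
      exact (hc hx).eq_zero ha hb
  have hQ' : IsPositiveCone Q := hQ.prop
  refine ⟨Q, hPQ, hQ', fun x => or_iff_not_imp_left.2 fun hx => ?_⟩
  refine hQ.le_of_ge (hQ'.adjoin_neg hx) ?_ ?_
  · exact fun s hs => ⟨s, hs, 0, hQ'.zero_mem, by ring⟩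
  · exact ⟨0, hQ'.zero_mem, 1, hQ'.one_mem, by ring⟩

/-- The linear order with a given total positive cone. -/
noncomputable abbrev linearOrder (hP : IsPositiveCone P) (htot : ∀ x, x ∈ P ∨ -x ∈ P) :
    LinearOrder K where
  __ := hP.partialOrder
  le_total a b := by
    rcases htot (b - a) with h | h
    · exact Or.inl h
    · right
      rw [neg_sub] at h
      exact h
  toDecidableLE := Classical.decRel _

theorem isStrictOrderedRing (hP : IsPositiveCone P) (htot : ∀ x, x ∈ P ∨ -x ∈ P) :
    @IsStrictOrderedRing K _ (hP.linearOrder htot).toPartialOrder := by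
  let := hP.linearOrder htot
  have : IsRealPoring K := hP.isRealPoring
  exact IsOrderedRing.toIsStrictOrderedRing K

end IsPositiveCone

/-! ### From the absence of ordered integral extensions to the intermediate value property -/

section IntermediateValue

open Polynomial

variable {R : Type u} [Field R] [LinearOrder R] [IsStrictOrderedRing R]

/-- If an irreducible polynomial changes sign and polynomials of smaller degree have the
intermediate value property, then the ordering extends to the stem field. -/
theorem exists_isPositiveCone_adjoinRoot {f : R[X]} [hf : Fact (Irreducible f)] {a b : R}
    (hab : f.eval a * f.eval b < 0)
    (ih : ∀ h : R[X], h.natDegree < f.natDegree → h.eval a * h.eval b < 0 → ∃ c, h.eval c = 0) :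
    ∃ Q : Set (AdjoinRoot f), IsPositiveCone Q ∧ ∀ x, 0 ≤ x → AdjoinRoot.of f x ∈ Q := by
  have hn : 0 < f.natDegree := hf.out.natDegree_pos
  have hf0 : f ≠ 0 := hf.out.ne_zero
  -- The sums of elements of `W` form the smallest candidate cone; the task is to see that it omits
  -- `-1`.
  let W : Submonoid (AdjoinRoot f) :=
    { carrier := {x | ∃ q : R, 0 ≤ q ∧ ∃ l, x = AdjoinRoot.of f q * (l * l)}
      one_mem' := ⟨1, zero_le_one, 1, by simp⟩
      mul_mem' := by
        rintro _ _ ⟨q, hq, l, rfl⟩ ⟨q', hq', l', rfl⟩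
        exact ⟨q * q', mul_nonneg hq hq', l * l', by rw [map_mul]; ring⟩ }
  have hrep : ∀ x ∈ AddSubmonoid.closure (W : Set (AdjoinRoot f)), ∃ g : R[X],
      AdjoinRoot.mk f g = x ∧ g.natDegree ≤ 2 * (f.natDegree - 1) ∧ ∀ r, 0 ≤ g.eval r := by
    intro x hx
    induction hx using AddSubmonoid.closure_induction with
    | mem x hx =>
      obtain ⟨q, hq, l, rfl⟩ := hx
      obtain ⟨g, rfl⟩ := AdjoinRoot.mk_surjective l
      refine ⟨C q * ((g % f) * (g % f)), ?_, ?_, fun r => ?_⟩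
      · have : AdjoinRoot.mk f (g % f) = AdjoinRoot.mk f g := by
          rw [AdjoinRoot.mk_eq_mk]
          exact ⟨-(g / f), by linear_combination (EuclideanDomain.div_add_mod g f)⟩
        rw [map_mul, map_mul, this]; rfl
      · have h1 : (g % f).natDegree < f.natDegree := natDegree_mod_lt g hn.ne'
        have h2 := natDegree_C_mul_le q ((g % f) * (g % f))
        have h3 := natDegree_mul_le (p := g % f) (q := g % f)
        lia
      · simp only [eval_mul, eval_C]
        exact mul_nonneg hq (mul_self_nonneg _)
    | zero => exact ⟨0, by simp, by simp, by simp⟩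
    | add x y _ _ hx hy =>
      obtain ⟨g, rfl, hg, hg'⟩ := hx
      obtain ⟨h, rfl, hh, hh'⟩ := hy
      refine ⟨g + h, map_add _ _ _, (natDegree_add_le _ _).trans (max_le hg hh), fun r => ?_⟩
      rw [eval_add]
      exact add_nonneg (hg' r) (hh' r)
  refine ⟨W.subsemiringClosure, IsPositiveCone.of_neg_one_notMem (fun ha hb => add_mem ha hb)
    (fun ha hb => mul_mem ha hb) (fun x => ?_) (fun hneg => ?_), fun x hx => ?_⟩
  · exact (Submonoid.subsemiringClosure_mem W).2
      (AddSubmonoid.subset_closure ⟨1, zero_le_one, x, by simp⟩)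
  -- If `-1` is represented by `g ≥ 0` of degree at most `2(n - 1)`, where `n = deg f`, then `g + 1
  -- = f * h` with `deg h < n`. Since `f * h > 0` on `R`, the cofactor `h` changes sign with `f`, so
  -- it has a root by `ih`, where `f * h` vanishes.
  · obtain ⟨g, hg, hdeg, hpos⟩ := hrep _ ((Submonoid.subsemiringClosure_mem W).1 hneg)
    have hdvd : f ∣ g + 1 := by
      rw [← AdjoinRoot.mk_eq_zero, map_add, hg, map_one, neg_add_cancel]
    obtain ⟨h, hh⟩ := hdvd
    have hev : ∀ r, 0 < f.eval r * h.eval r := fun r => by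
      rw [← eval_mul, ← hh, eval_add, eval_one]
      linarith [hpos r]
    have hh0 : h ≠ 0 := by
      rintro rfl
      simpa using hev 0
    have hlt : h.natDegree < f.natDegree := by
      have h1 := natDegree_mul hf0 hh0
      rw [← hh] at h1
      have h2 := natDegree_add_le g 1
      rw [natDegree_one] at h2
      have h3 : max g.natDegree 0 = g.natDegree := by simp
      lia
    have hsgn : h.eval a * h.eval b < 0 := by
      have h1 := mul_pos (hev a) (hev b)
      by_contra hcon
      push Not at hcon
      nlinarith [mul_nonneg hcon (neg_pos.2 hab).le]
    obtain ⟨c, hc⟩ := ih h hlt hsgn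
    have := hev c
    rw [hc, mul_zero] at this
    exact lt_irrefl _ this
  · exact (Submonoid.subsemiringClosure_mem W).2
      (AddSubmonoid.subset_closure ⟨x, hx, 1, by simp⟩)

/-- By induction on the degree. If `f` factors, one factor changes sign. If `f` is irreducible, its
stem field carries a compatible cone, hence equals `R`; then `f` is linear, and the sign change
locates its root. -/
theorem exists_root_of_forall_surjective
    (hR : ∀ (L : Type u) [Field L] (i : R →+* L), i.IsIntegral → ∀ Q : Set L, IsPositiveCone Q →
      (∀ x, 0 ≤ x → i x ∈ Q) → Function.Surjective i)
    (f : R[X]) {a b : R} (hab : f.eval a * f.eval b < 0) :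
    ∃ c, f.eval c = 0 ∧ 0 ≤ (c - a) * (b - c) := by
  induction hn : f.natDegree using Nat.strong_induction_on generalizing f with
  | _ n ih =>
  subst hn
  have hf0 : f ≠ 0 := by rintro rfl; simp at hab
  have hdeg : f.natDegree ≠ 0 := by
    intro h
    rw [eq_C_of_natDegree_eq_zero h] at hab
    simp only [eval_C] at hab
    exact absurd (mul_self_nonneg _) (not_le.2 hab)
  have hunit : ¬ IsUnit f := fun h => hdeg (natDegree_eq_zero_of_isUnit h)
  by_cases hirr : Irreducible f
  · have : Fact (Irreducible f) := ⟨hirr⟩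
    obtain ⟨Q, hQ, hQ'⟩ := exists_isPositiveCone_adjoinRoot hab fun h hlt hsgn =>
      (ih _ hlt h hsgn rfl).imp fun _ => And.left
    have hintegral : (AdjoinRoot.of f).IsIntegral := by
      have : Module.Finite R (AdjoinRoot f) := (AdjoinRoot.powerBasis hf0).finite
      exact (inferInstance : Algebra.IsIntegral R (AdjoinRoot f)).isIntegral
    obtain ⟨c, hc⟩ := hR (AdjoinRoot f) (AdjoinRoot.of f) hintegral Q hQ hQ' (AdjoinRoot.root f)
    have hroot : f.eval c = 0 := by
      have := AdjoinRoot.eval₂_root f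
      rw [← hc, eval₂_at_apply] at this
      exact (AdjoinRoot.of f).injective (this.trans (map_zero _).symm)
    refine ⟨c, hroot, ?_⟩
    obtain ⟨k, hk⟩ := dvd_iff_isRoot.2 hroot
    have hku : IsUnit k := (hirr.isUnit_or_isUnit hk).resolve_left (not_isUnit_X_sub_C c)
    obtain ⟨κ, -, rfl⟩ := isUnit_iff.1 hku
    rw [hk] at hab
    simp only [eval_mul, eval_sub, eval_X, eval_C] at hab
    by_contra hcon
    push Not at hcon
    nlinarith [mul_nonneg (neg_pos.2 hcon).le (mul_self_nonneg κ)]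
  · have : ∃ g h : R[X], f = g * h ∧ ¬ IsUnit g ∧ ¬ IsUnit h := by
      by_contra hcon
      push Not at hcon
      exact hirr ⟨hunit, fun g h hgh => or_iff_not_imp_left.2 fun hg => hcon g h hgh hg⟩
    obtain ⟨g, h, rfl, hg, hh⟩ := this
    have hg0 : g ≠ 0 := left_ne_zero_of_mul hf0
    have hh0 : h ≠ 0 := right_ne_zero_of_mul hf0
    have hnd := natDegree_mul hg0 hh0
    have hgd : 0 < g.natDegree := natDegree_pos_iff_degree_pos.2 (degree_pos_of_ne_zero_of_nonunit hg0 hg)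
    have hhd : 0 < h.natDegree := natDegree_pos_iff_degree_pos.2 (degree_pos_of_ne_zero_of_nonunit hh0 hh)
    simp only [eval_mul] at hab
    by_cases hgab : g.eval a * g.eval b < 0
    · obtain ⟨c, hc, hc'⟩ := ih _ (by lia) g hgab rfl
      exact ⟨c, by rw [eval_mul, hc, zero_mul], hc'⟩
    · have hhab : h.eval a * h.eval b < 0 := by
        by_contra hcon
        push Not at hcon hgab
        nlinarith [mul_nonneg hcon hgab]
      obtain ⟨c, hc, hc'⟩ := ih _ (by lia) h hhab rfl
      exact ⟨c, by rw [eval_mul, hc, mul_zero], hc'⟩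

theorem isIVTField_of_forall_surjective
    (hR : ∀ (L : Type u) [Field L] (i : R →+* L), i.IsIntegral → ∀ Q : Set L, IsPositiveCone Q →
      (∀ x, 0 ≤ x → i x ∈ Q) → Function.Surjective i) :
    IsIVTField R ∧ ∀ x : R, 0 ≤ x → IsSquare x := by
  have hsq : ∀ x : R, 0 ≤ x → IsSquare x := by
    intro x hx
    rcases hx.eq_or_lt with rfl | hx
    · exact ⟨0, by simp⟩
    -- The values at the endpoints are `-x < 0` and `x ^ 2 + x + 1 > 0`.
    obtain ⟨c, hc, -⟩ := exists_root_of_forall_surjective hR (X ^ 2 - C x) (a := 0) (b := x + 1)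
      (by
        simp only [eval_sub, eval_pow, eval_X, eval_C]
        nlinarith [mul_pos hx hx, mul_pos hx (mul_pos hx hx)])
    simp only [eval_sub, eval_pow, eval_X, eval_C] at hc
    exact ⟨c, by linear_combination -hc⟩
  have hsq' : ∀ x : R, IsSquare x ↔ 0 ≤ x := fun x => ⟨fun h => h.nonneg, hsq x⟩
  refine ⟨⟨fun hx hy => ?_, ?_, fun x => ?_, fun f a b h => ?_⟩, hsq⟩
  · rw [hsq'] at *
    exact add_nonneg hx hy
  · rw [hsq']
    simp
  · rw [hsq', hsq']
    exact (le_total 0 x).imp id neg_nonneg.2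
  · rw [hsq', neg_nonneg] at h
    rcases h.eq_or_lt with h | h
    · rcases mul_eq_zero.1 h with h | h
      · exact ⟨a, h, 0, by simp⟩
      · exact ⟨b, h, 0, by simp⟩
    · obtain ⟨c, hc, hc'⟩ := exists_root_of_forall_surjective hR f h
      exact ⟨c, hc, hsq _ hc'⟩

end IntermediateValue

/-- Between fields every extension is essential, so only integrality and a compatible cone matter.
The partial order is first extended to a total one; extensions of the latter are extensions of the
former. -/
theorem IsRealClosedStar.isIVTField {R : Type u} [Field R] [PartialOrder R]
    (hR : IsRealClosedStar R) : IsIVTField R ∧ ∀ x : R, 0 ≤ x → IsSquare x := by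
  have := hR.1
  obtain ⟨Q, hPQ, hQ, htot⟩ := (isPositiveCone_nonneg R).exists_total
  have key : ∀ (L : Type u) [Field L] (i : R →+* L), i.IsIntegral → ∀ Q' : Set L,
      IsPositiveCone Q' → (∀ x ∈ Q, i x ∈ Q') → Function.Surjective i := by
    intro L _ i hi Q' hQ' hQQ'
    let : PartialOrder L := hQ'.partialOrder
    have : IsRealPoring L := hQ'.isRealPoring
    refine hR.2 L (i.toOrderRingHom fun x hx => hQ'.nonneg_iff.2 (hQQ' x (hPQ hx)))
      ((isEssentialExtension_iff _).2 ⟨i.injective, fun b hb => ⟨b⁻¹, 1, one_ne_zero, ?_⟩⟩) hi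
    rw [map_one, inv_mul_cancel₀ hb]
  have h2 := @isIVTField_of_forall_surjective R _ (hQ.linearOrder htot)
    (hQ.isStrictOrderedRing htot) (fun L _ i hi Q' hQ' h =>
      key L i hi Q' hQ' fun x hx => h x (hQ.nonneg_iff.2 hx))
  exact ⟨h2.1, fun x hx => h2.2 x (hQ.nonneg_iff.2 (hPQ hx))⟩

/-- Existence of real closures of partially ordered fields. -/
theorem IsPositiveCone.exists_ringHom_isIVTField {K : Type u} [Field K] {P : Set K}
    (hP : IsPositiveCone P) : ∃ (R : Type u) (_ : Field R) (_ : IsIVTField R) (φ : K →+* R),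
      ∀ x ∈ P, IsSquare (φ x) := by
  let : PartialOrder K := hP.partialOrder
  have : IsRealPoring K := hP.isRealPoring
  obtain ⟨C, _, _, f, hf⟩ := hasRealClosureStar K
  have : Nontrivial C := hf.essential.1.nontrivial
  -- By essentiality a nonzero element of `C` divides a nonzero element of `K`, which is a unit.
  have hfield : IsField C :=
    { exists_pair_ne := exists_pair_ne C
      mul_comm := mul_comm
      mul_inv_cancel := fun {c} hc => by
        obtain ⟨d, a, ha, hda⟩ := ((isEssentialExtension_iff _).1 hf.essential).2 c hc
        refine ⟨d * f a⁻¹, ?_⟩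
        have h1 : (f a⁻¹ : C) * f a = 1 := by rw [← map_mul, inv_mul_cancel₀ ha, map_one]
        have h2 : d * c = f a := hda
        linear_combination (f a⁻¹ : C) * h2 + h1 }
  let : Field C := hfield.toField
  have hC := IsRealClosedStar.isIVTField hf.realClosedStar
  exact ⟨C, hfield.toField, hC.1, (f : K →+* C), fun x hx => hC.2 _ (by
    simpa using f.monotone' (hP.nonneg_iff.2 hx))⟩

/-! ### Structure of von Neumann regular real closed `*` rings -/

namespace IsIVTField

variable {R : Type u} [Field R] [IsIVTField R]

variable (R) in
theorem isPositiveCone_isSquare : IsPositiveCone {x : R | IsSquare x} :=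
  .of_neg_one_notMem (fun ha hb => isSquare_add ha hb) (fun ha hb => IsSquare.mul ha hb)
    (fun a => ⟨a, rfl⟩) not_isSquare_neg_one

theorem eq_zero {x : R} (h : IsSquare x) (h' : IsSquare (-x)) : x = 0 :=
  (isPositiveCone_isSquare R).eq_zero h h'

end IsIVTField

/-! ### Retraction from an integral closure in a product of real closed fields -/

section Family

variable {C : Type u} [CommRing C] [PartialOrder C] {ι : Type u} {R : ι → Type u}
  [∀ i, Field (R i)] [∀ i, IsIVTField (R i)]

/-- A von Neumann regular real closed `*` ring is a retract of its integral closure in a product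
of real closed fields. -/
theorem IsRealClosedStar.exists_retraction_pi (hC : IsRealClosedStar C)
    (hCr : IsVonNeumannRegular C) (φ : ∀ i, C →+* R i)
    (hinj : ∀ c, (∀ i, φ i c = 0) → c = 0) (hsq : ∀ i c, 0 ≤ c → IsSquare (φ i c)) :
    ∃ (S : Subring (∀ i, R i)) (k : C →+* S) (r : S →+* C),
      (∀ x, (RingHom.pi φ).IsIntegralElem x → x ∈ S) ∧ (∀ c i, (k c).1 i = φ i c) ∧
      (∀ c, r (k c) = c) ∧ ∀ x : S, (∀ i, IsSquare (x.1 i)) → IsSquare (r x) := by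
  let : Algebra C (∀ i, R i) := (RingHom.pi φ).toAlgebra
  let S := integralClosure C (∀ i, R i)
  have hP : IsPositiveCone {x : S | ∀ i, IsSquare (x.1 i)} :=
    { add_mem := fun ha hb i => IsIVTField.isSquare_add (ha i) (hb i)
      mul_mem := fun ha hb i => IsSquare.mul (ha i) (hb i)
      mul_self_mem := fun a i => ⟨a.1 i, rfl⟩
      eq_zero := fun ha hb => Subtype.ext (funext fun i => IsIVTField.eq_zero (ha i) (hb i)) }
  have : IsReduced S := isReduced_of_injective S.val Subtype.val_injective
  obtain ⟨r, hr⟩ := hC.exists_retraction hCr hP (algebraMap C S)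
    ((injective_iff_map_eq_zero _).2 fun c hc => hinj c fun i =>
      congrFun (congrArg Subtype.val hc) i)
    (fun c hc i => hsq i c hc) (inferInstance : Algebra.IsIntegral C S).isIntegral
  refine ⟨S.toSubring, algebraMap C S, r, fun x hx => hx, fun c i => rfl, hr, fun x hx => ?_⟩
  choose s hs using hx
  have hsx : s * s = x.1 := funext fun i => (hs i).symm
  -- Square roots chosen independently at each coordinate are still integral, so `r` applies to
  -- them.
  have hintegral : IsIntegral C s := IsIntegral.of_pow two_pos (by rw [pow_two, hsx]; exact x.2)
  refine ⟨r ⟨s, hintegral⟩, ?_⟩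
  rw [← map_mul]
  exact congrArg r (Subtype.ext hsx.symm)

end Family

section Structure

variable {C : Type u} [CommRing C] [PartialOrder C]

/-- Every residue ring of a real von Neumann regular poring at a prime ideal embeds into a real
closed field. -/
theorem exists_ringHom_isIVTField [IsRealPoring C] (hCr : IsVonNeumannRegular C)
    (p : PrimeSpectrum C) : ∃ (R : Type u) (_ : Field R) (_ : IsIVTField R) (φ : C →+* R),
      (∀ c, φ c = 0 → c ∈ p.asIdeal) ∧ ∀ c, 0 ≤ c → IsSquare (φ c) := by
  have : p.asIdeal.IsMaximal := hCr.isMaximal_of_isPrime _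
  let : Field (C ⧸ p.asIdeal) := Ideal.Quotient.field _
  obtain ⟨R, _, _, φ, hφ⟩ := ((isPositiveCone_nonneg C).image_quotientMk hCr
    p.asIdeal).exists_ringHom_isIVTField
  refine ⟨R, inferInstance, inferInstance, φ.comp (Ideal.Quotient.mk p.asIdeal),
    fun c hc => ?_, fun c hc => hφ _ ⟨c, hc, rfl⟩⟩
  rw [← Ideal.Quotient.eq_zero_iff_mem]
  exact φ.injective (hc.trans (map_zero φ).symm)

namespace IsRealClosedStar

/-- A von Neumann regular real closed `*` ring is a retract of its integral closure in a product
of real closed fields. -/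
theorem exists_family (hC : IsRealClosedStar C) (hCr : IsVonNeumannRegular C) :
    ∃ (R : PrimeSpectrum C → Type u) (_ : ∀ i, Field (R i)) (_ : ∀ i, IsIVTField (R i))
      (φ : ∀ i, C →+* R i) (S : Subring (∀ i, R i)) (k : C →+* S) (r : S →+* C),
      (∀ i c, 0 ≤ c → IsSquare (φ i c)) ∧
      (∀ x, (RingHom.pi φ).IsIntegralElem x → x ∈ S) ∧ (∀ c i, (k c).1 i = φ i c) ∧
      (∀ c, r (k c) = c) ∧ ∀ x : S, (∀ i, IsSquare (x.1 i)) → IsSquare (r x) := by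
  have := hC.1
  choose R hF hR φ hφ hsq using exists_ringHom_isIVTField (C := C) hCr
  obtain ⟨S, k, r, h⟩ := hC.exists_retraction_pi hCr φ (fun c hc => by
    have h2 : c ∈ nilradical C := nilpotent_iff_mem_prime.2 fun J hJ => hφ ⟨J, hJ⟩ c (hc _)
    rwa [nilradical_eq_zero, Ideal.zero_eq_bot, Ideal.mem_bot] at h2) hsq
  exact ⟨R, hF, hR, φ, S, k, r, hsq, h⟩

theorem isSquare_of_nonneg (hC : IsRealClosedStar C) (hCr : IsVonNeumannRegular C) {c : C}
    (hc : 0 ≤ c) : IsSquare c := by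
  obtain ⟨R, _, _, φ, S, k, r, hφ, hS, hk, hr, hsq⟩ := hC.exists_family hCr
  rw [← hr c]
  exact hsq _ fun i => by rw [hk]; exact hφ i c hc

/-- Nonnegative elements are exactly squares. -/
theorem nonneg_iff_isSquare (hC : IsRealClosedStar C) (hCr : IsVonNeumannRegular C) {c : C} :
    0 ≤ c ↔ IsSquare c := by
  have := hC.1
  refine ⟨hC.isSquare_of_nonneg hCr, ?_⟩
  rintro ⟨s, rfl⟩
  exact (isPositiveCone_nonneg C).mul_self_mem s

theorem isPositiveCone_isSquare (hC : IsRealClosedStar C) (hCr : IsVonNeumannRegular C) :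
    IsPositiveCone {c : C | IsSquare c} := by
  have := hC.1
  have h := isPositiveCone_nonneg C
  simpa only [hC.nonneg_iff_isSquare hCr] using h

open Polynomial in
/-- The intermediate value property for monic polynomials over a von Neumann regular real closed
`*` ring, on a clopen set. -/
theorem exists_idempotent_root (hC : IsRealClosedStar C) (hCr : IsVonNeumannRegular C)
    {F : C[X]} (hF : F.Monic) (a b : C) : ∃ g c : C, g * g = g ∧
      IsSquare ((1 - g) * (F.eval a * F.eval b)) ∧ IsSquare (-(g * (F.eval a * F.eval b))) ∧
      g * F.eval c = 0 ∧ IsSquare (g * ((c - a) * (b - c))) := by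
  classical
  obtain ⟨R, _, _, φ, S, k, r, -, hS, hk, hr, hsq⟩ := hC.exists_family hCr
  have hev : ∀ c i, φ i (F.eval c) = (F.map (φ i)).eval (φ i c) := fun c i => by
    rw [eval_map, eval₂_at_apply]
  let p : PrimeSpectrum C → Prop := fun i => IsSquare (-(φ i (F.eval a) * φ i (F.eval b)))
  have hroot : ∀ i, p i → ∃ c : R i, (F.map (φ i)).eval c = 0 ∧
      IsSquare ((c - φ i a) * (φ i b - c)) := fun i hi =>
    IsIVTField.exists_root _ _ _ (by rw [← hev, ← hev]; exact hi)
  let g₀ : ∀ i, R i := fun i => if p i then 1 else 0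
  -- The default value `φ i a` makes `s₀` a root of the monic polynomial `F * (X - a)` at every
  -- coordinate, hence integral over `C`.
  let s₀ : ∀ i, R i := fun i => if h : p i then (hroot i h).choose else φ i a
  have hg₀ : g₀ * g₀ = g₀ := funext fun i => by
    by_cases h : p i <;> simp [g₀, h]
  have hs₀ : ∀ i, p i → (F.map (φ i)).eval (s₀ i) = 0 ∧
      IsSquare ((s₀ i - φ i a) * (φ i b - s₀ i)) := fun i hi => by
    have : s₀ i = (hroot i hi).choose := dif_pos hi
    rw [this]
    exact (hroot i hi).choose_spec
  have hs₀' : ∀ i, ¬ p i → s₀ i = φ i a := fun i hi => dif_neg hi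
  have hgS : g₀ ∈ S := hS _ ⟨X ^ 2 - X, monic_X_pow_sub (by
    exact lt_of_le_of_lt degree_X_le (by norm_num)), by
    rw [eval₂_sub, eval₂_pow, eval₂_X, pow_two, hg₀, sub_self]⟩
  have hsS : s₀ ∈ S := hS _ ⟨F * (X - Polynomial.C a), hF.mul (monic_X_sub_C a), funext fun i => by
    have := hom_eval₂ (F * (X - Polynomial.C a)) (RingHom.pi φ) (Pi.evalRingHom R i) s₀
    refine this.trans ?_
    change eval₂ (φ i) (s₀ i) _ = 0
    rw [eval₂_mul]
    by_cases hi : p i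
    · rw [← eval_map, (hs₀ i hi).1, zero_mul]
    · rw [eval₂_sub, eval₂_X, eval₂_C, hs₀' i hi, sub_self, mul_zero]⟩
  let g : S := ⟨g₀, hgS⟩
  let s : S := ⟨s₀, hsS⟩
  have hg : g * g = g := Subtype.ext hg₀
  have hFs : r (eval₂ k s F) = F.eval (r s) := by
    rw [hom_eval₂, show r.comp k = RingHom.id C from RingHom.ext hr]; rfl
  have hFi : ∀ i, (eval₂ k s F).1 i = (F.map (φ i)).eval (s₀ i) := fun i => by
    have := hom_eval₂ F k ((Pi.evalRingHom R i).comp S.subtype) s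
    refine this.trans ?_
    rw [eval_map, show ((Pi.evalRingHom R i).comp S.subtype).comp k = φ i from
      RingHom.ext fun c => hk c i]
    rfl
  refine ⟨r g, r s, by rw [← map_mul, hg], ?_, ?_, ?_, ?_⟩
  · have h := hsq ((1 - g) * k (F.eval a * F.eval b)) fun i => by
      change IsSquare ((1 - g₀ i) * (k (F.eval a * F.eval b)).1 i)
      rw [hk, map_mul]
      by_cases hi : p i
      · simp [g₀, hi]
      · simp only [g₀, hi, if_false, sub_zero, one_mul]
        exact (IsIVTField.isSquare_or_isSquare_neg _).resolve_right hi
    simpa only [map_mul, map_sub, map_one, hr] using h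
  · have h := hsq (-(g * k (F.eval a * F.eval b))) fun i => by
      change IsSquare (-(g₀ i * (k (F.eval a * F.eval b)).1 i))
      rw [hk, map_mul]
      by_cases hi : p i
      · simp only [g₀, hi, if_true, one_mul]
        exact hi
      · simp [g₀, hi]
    simpa only [map_mul, map_neg, hr] using h
  · rw [← hFs, ← map_mul]
    have : g * eval₂ k s F = 0 := Subtype.ext (funext fun i => by
      change g₀ i * (eval₂ k s F).1 i = 0
      rw [hFi]
      by_cases hi : p i
      · rw [(hs₀ i hi).1, mul_zero]
      · simp [g₀, hi])
    rw [this, map_zero]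
  · have h := hsq (g * ((s - k a) * (k b - s))) fun i => by
      change IsSquare (g₀ i * ((s₀ i - (k a).1 i) * ((k b).1 i - s₀ i)))
      rw [hk, hk]
      by_cases hi : p i
      · simp only [g₀, hi, if_true, one_mul]
        exact (hs₀ i hi).2
      · simp [g₀, hi]
    simpa only [map_mul, map_sub, hr] using h

/-- Every element is a square on a clopen set and minus a square on its complement. -/
theorem exists_idempotent_isSquare (hC : IsRealClosedStar C) (hCr : IsVonNeumannRegular C)
    (c : C) : ∃ g : C, g * g = g ∧ IsSquare (g * c) ∧ IsSquare (-((1 - g) * c)) := by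
  -- For `F = X` and endpoints `c`, `1`, the product of the end values is `c` itself.
  obtain ⟨g, -, hg, h1, h2, -, -⟩ :=
    hC.exists_idempotent_root hCr (Polynomial.monic_X (R := C)) c 1
  simp only [Polynomial.eval_X, mul_one] at h1 h2
  refine ⟨1 - g, by linear_combination hg, h1, ?_⟩
  rwa [sub_sub_cancel]

open Polynomial in
/-- The residue fields of a von Neumann regular real closed `*` ring are real closed. -/
theorem isIVTField_quotient (hC : IsRealClosedStar C) (hCr : IsVonNeumannRegular C)
    {L : Type u} [Field L] (π : C →+* L) (hπ : Function.Surjective π) : IsIVTField L := by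
  have hidem : ∀ g : C, g * g = g → π g = 0 ∨ π g = 1 := fun g hg => by
    have h1 : π g * π g = π g := by rw [← map_mul, hg]
    have h2 : π g * (π g - 1) = 0 := by linear_combination h1
    exact (mul_eq_zero.1 h2).imp id sub_eq_zero.1
  have hlift : ∀ x : L, IsSquare x → ∃ c : C, IsSquare c ∧ π c = x := by
    rintro _ ⟨y, rfl⟩
    obtain ⟨c, rfl⟩ := hπ y
    exact ⟨c * c, ⟨c, rfl⟩, map_mul _ _ _⟩
  have hcone := hC.isPositiveCone_isSquare hCr
  have hadd : ∀ {x y : L}, IsSquare x → IsSquare y → IsSquare (x + y) := by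
    intro x y hx hy
    obtain ⟨c, hc, rfl⟩ := hlift x hx
    obtain ⟨d, hd, rfl⟩ := hlift y hy
    rw [← map_add]
    exact (hcone.add_mem hc hd : IsSquare (c + d)).map π
  have hneg : ¬ IsSquare (-1 : L) := by
    intro h
    obtain ⟨c, hc, hc1⟩ := hlift _ h
    -- The idempotent `1 - (c + 1) * d` annihilates `c + 1`, so it equals minus its product with the
    -- square `c`. It must therefore vanish, although `π` sends it to `1`.
    obtain ⟨d, h1, h2⟩ := hCr.exists_idempotent (c + 1)
    have hsq : IsSquare (1 - (c + 1) * d) := ⟨1 - (c + 1) * d, by linear_combination -h1⟩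
    have h3 : (1 - (c + 1) * d) * 1 = 0 := by
      refine hcone.eq_zero (IsSquare.mul hsq ⟨1, by simp⟩) ?_
      have : -((1 - (c + 1) * d) * 1) = (1 - (c + 1) * d) * c := by linear_combination h2
      rw [this]
      exact hsq.mul hc
    have h4 := congrArg π h3
    rw [map_mul, map_sub, map_mul, map_add, hc1, map_one, map_zero] at h4
    simp at h4
  have hzero : ∀ {x : L}, IsSquare x → IsSquare (-x) → x = 0 := fun h h' =>
    (IsPositiveCone.of_neg_one_notMem (P := {x : L | IsSquare x}) hadd
      (fun ha hb => IsSquare.mul ha hb) (fun a => ⟨a, rfl⟩) hneg).eq_zero h h'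
  refine ⟨hadd, hneg, fun x => ?_, fun f a b h => ?_⟩
  · obtain ⟨c, rfl⟩ := hπ x
    obtain ⟨g, hg, h1, h2⟩ := hC.exists_idempotent_isSquare hCr c
    replace h1 := h1.map π
    replace h2 := h2.map π
    rcases hidem g hg with h0 | h0
    · right
      simpa [h0] using h2
    · left
      simpa [h0] using h1
  · by_cases hf0 : f = 0
    · exact ⟨a, by simp [hf0], 0, by simp⟩
    have hl : f.leadingCoeff ≠ 0 := leadingCoeff_ne_zero.2 hf0
    -- Normalizing `f` to be monic changes the product of its two end values only by a nonzero
    -- square.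
    obtain ⟨F, hFf, -, hF⟩ := lifts_and_degree_eq_and_monic
      (f := π) (p := f * Polynomial.C f.leadingCoeff⁻¹)
      ((lifts_iff_coeff_lifts _).2 fun n => hπ _) (monic_mul_leadingCoeff_inv hf0)
    obtain ⟨a, rfl⟩ := hπ a
    obtain ⟨b, rfl⟩ := hπ b
    have hev : ∀ c, π (F.eval c) = f.eval (π c) * f.leadingCoeff⁻¹ := fun c => by
      rw [← eval₂_at_apply, ← eval_map, hFf, eval_mul, eval_C]
    obtain ⟨g, c, hg, h1, -, h3, h4⟩ := hC.exists_idempotent_root hCr hF a b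
    replace h1 := h1.map π
    replace h3 := congrArg π h3
    replace h4 := h4.map π
    rcases hidem g hg with h0 | h0
    -- If `π g = 0`, the product of the end values is both a square and minus a square, hence zero,
    -- and an endpoint is a root.
    · simp only [map_mul, map_sub, map_one, h0, sub_zero, one_mul, hev] at h1
      have h5 : f.eval (π a) * f.eval (π b) = 0 := by
        refine hzero ?_ h
        have := h1.mul (⟨f.leadingCoeff, rfl⟩ : IsSquare (f.leadingCoeff * f.leadingCoeff))
        have e : f.eval (π a) * f.leadingCoeff⁻¹ * (f.eval (π b) * f.leadingCoeff⁻¹) *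
            (f.leadingCoeff * f.leadingCoeff) = f.eval (π a) * f.eval (π b) := by
          field_simp
        rwa [e] at this
      rcases mul_eq_zero.1 h5 with h5 | h5
      · exact ⟨π a, h5, 0, by simp⟩
      · exact ⟨π b, h5, 0, by simp⟩
    · refine ⟨π c, ?_, ?_⟩
      · rw [map_mul, h0, one_mul, hev, map_zero] at h3
        exact (mul_eq_zero.1 h3).resolve_right (inv_ne_zero hl)
      · simpa only [map_mul, map_sub, h0, one_mul] using h4

end IsRealClosedStar

end Structure

/-! ### Uniqueness of real closures of ordered fields -/

namespace IsIVTField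

open Polynomial

/-! ### Rolle, mean value and monotonicity for polynomials over a real closed field -/

section Order

variable {R : Type u} [Field R] [LinearOrder R] [IsStrictOrderedRing R] [IsIVTField R]

theorem isSquare_iff_nonneg {x : R} : IsSquare x ↔ 0 ≤ x := by
  refine ⟨fun h => h.nonneg, fun h => ?_⟩
  rcases isSquare_or_isSquare_neg x with h' | h'
  · exact h'
  · have : x = 0 := le_antisymm (neg_nonneg.1 h'.nonneg) h
    exact ⟨0, by simp [this]⟩

theorem exists_root_mem_Icc (f : R[X]) {a b : R} (hab : a ≤ b) (h : f.eval a * f.eval b ≤ 0) :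
    ∃ c ∈ Set.Icc a b, f.eval c = 0 := by
  obtain ⟨c, hc, hc'⟩ := exists_root f a b (isSquare_iff_nonneg.2 (neg_nonneg.2 h))
  rw [isSquare_iff_nonneg] at hc'
  refine ⟨c, ⟨?_, ?_⟩, hc⟩
  · by_contra hlt
    push Not at hlt
    nlinarith [mul_pos (sub_pos.2 hlt) (sub_pos.2 (hlt.trans_le hab))]
  · by_contra hlt
    push Not at hlt
    nlinarith [mul_pos (sub_pos.2 hlt) (sub_pos.2 (hab.trans_lt hlt))]

theorem eval_mul_eval_pos_of_Icc (f : R[X]) {a b : R} (hab : a ≤ b)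
    (h : ∀ c ∈ Set.Icc a b, f.eval c ≠ 0) : 0 < f.eval a * f.eval b := by
  by_contra hcon
  obtain ⟨c, hc, hc'⟩ := exists_root_mem_Icc f hab (not_lt.1 hcon)
  exact h c hc hc'

/-- A polynomial without roots between two points has the same sign at these points. -/
theorem eval_mul_eval_pos (f : R[X]) (a b : R)
    (h : ∀ c ∈ Set.uIcc a b, f.eval c ≠ 0) : 0 < f.eval a * f.eval b := by
  rcases le_total a b with hab | hab
  · rw [Set.uIcc_of_le hab] at h
    exact eval_mul_eval_pos_of_Icc f hab h
  · rw [Set.uIcc_of_ge hab] at h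
    rw [mul_comm]
    exact eval_mul_eval_pos_of_Icc f hab h

/-- Write `p = (X - a) ^ (m + 1) * (X - b) ^ (k + 1) * g` with `g` of constant sign on `[a, b]`.
Then `p' = (X - a) ^ m * (X - b) ^ k * H`, and `H` takes values of opposite signs at `a` and `b`. -/
theorem exists_derivative_eq_zero_of_consecutive (p : R[X]) (hp : p ≠ 0) {a b : R} (hab : a < b)
    (ha : p.eval a = 0) (hb : p.eval b = 0) (hroot : ∀ c ∈ Set.Ioo a b, p.eval c ≠ 0) :
    ∃ c ∈ Set.Ioo a b, p.derivative.eval c = 0 := by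
  obtain ⟨q, hq, hqa⟩ := exists_eq_pow_rootMultiplicity_mul_and_not_dvd p hp a
  have hq0 : q ≠ 0 := by rintro rfl; simp at hqa
  obtain ⟨g, hg, hgb⟩ := exists_eq_pow_rootMultiplicity_mul_and_not_dvd q hq0 b
  rw [dvd_iff_isRoot, IsRoot.def] at hqa hgb
  have hqb : q.eval b = 0 := by
    rw [hq, eval_mul] at hb
    refine (mul_eq_zero.1 hb).resolve_left ?_
    simp only [eval_pow, eval_sub, eval_X, eval_C]
    exact pow_ne_zero _ (sub_ne_zero.2 hab.ne')
  obtain ⟨m, hm⟩ : ∃ m, p.rootMultiplicity a = m + 1 :=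
    ⟨_, (Nat.succ_pred_eq_of_pos ((rootMultiplicity_pos hp).2 ha)).symm⟩
  obtain ⟨k, hk⟩ : ∃ k, q.rootMultiplicity b = k + 1 :=
    ⟨_, (Nat.succ_pred_eq_of_pos ((rootMultiplicity_pos hq0).2 hqb)).symm⟩
  rw [hm] at hq
  rw [hk] at hg
  have hga : g.eval a ≠ 0 := by
    intro h
    rw [hg, eval_mul, h, mul_zero] at hqa
    exact hqa rfl
  have hgpos : 0 < g.eval a * g.eval b := by
    refine eval_mul_eval_pos_of_Icc g hab.le fun c hc h => ?_
    have hca : c ≠ a := by rintro rfl; exact hga h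
    have hcb : c ≠ b := by rintro rfl; exact hgb h
    refine hroot c ⟨lt_of_le_of_ne hc.1 hca.symm, lt_of_le_of_ne hc.2 hcb⟩ ?_
    rw [hq, eval_mul, hg, eval_mul, h, mul_zero, mul_zero]
  let H : R[X] := (m + 1 : R[X]) * (X - C b) * g + (k + 1 : R[X]) * (X - C a) * g +
    (X - C a) * (X - C b) * derivative g
  have hder : derivative p = (X - C a) ^ m * (X - C b) ^ k * H := by
    rw [hq, hg]
    simp only [derivative_mul, derivative_pow_succ, derivative_sub, derivative_X, derivative_C, H]
    simp only [map_add, map_natCast, map_one]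
    ring
  have hHa : H.eval a = (m + 1) * (a - b) * g.eval a := by simp [H]
  have hHb : H.eval b = (k + 1) * (b - a) * g.eval b := by simp [H]
  have hm0 : (0 : R) < m + 1 := by positivity
  have hk0 : (0 : R) < k + 1 := by positivity
  have hneg : H.eval a * H.eval b < 0 := by
    have h1 : 0 < ((m + 1) * (k + 1)) * ((b - a) * (b - a)) * (g.eval a * g.eval b) :=
      mul_pos (mul_pos (mul_pos hm0 hk0) (mul_pos (sub_pos.2 hab) (sub_pos.2 hab))) hgpos
    rw [hHa, hHb]
    linarith
  obtain ⟨c, hc, hc0⟩ := exists_root_mem_Icc H hab.le hneg.le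
  have hca : c ≠ a := by rintro rfl; rw [hc0, zero_mul] at hneg; exact lt_irrefl _ hneg
  have hcb : c ≠ b := by rintro rfl; rw [hc0, mul_zero] at hneg; exact lt_irrefl _ hneg
  exact ⟨c, ⟨lt_of_le_of_ne hc.1 hca.symm, lt_of_le_of_ne hc.2 hcb⟩, by
    rw [hder, eval_mul, hc0, mul_zero]⟩

/-- Rolle's theorem for polynomials. -/
theorem exists_derivative_eq_zero (p : R[X]) (hp : p ≠ 0) {a b : R} (hab : a < b)
    (ha : p.eval a = 0) (hb : p.eval b = 0) : ∃ c ∈ Set.Ioo a b, p.derivative.eval c = 0 := by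
  classical
  -- The least root beyond `a` is consecutive to `a`.
  let s := p.roots.toFinset.filter (fun x => a < x)
  have hmem : ∀ x, x ∈ s ↔ p.eval x = 0 ∧ a < x := fun x => by
    simp [s, hp]
  obtain ⟨b', hb', hmin⟩ := s.exists_min_image id ⟨b, (hmem b).2 ⟨hb, hab⟩⟩
  obtain ⟨hb0, hab'⟩ := (hmem b').1 hb'
  have hb'b : b' ≤ b := hmin b ((hmem b).2 ⟨hb, hab⟩)
  obtain ⟨c, hc, hc0⟩ := exists_derivative_eq_zero_of_consecutive p hp hab' ha hb0
    fun c hc h => absurd (hmin c ((hmem c).2 ⟨h, hc.1⟩)) (not_le.2 hc.2)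
  exact ⟨c, ⟨hc.1, hc.2.trans_le hb'b⟩, hc0⟩

/-- The mean value theorem for polynomials. -/
theorem exists_derivative_mul_sub_eq (f : R[X]) {a b : R} (hab : a < b) :
    ∃ c ∈ Set.Ioo a b, f.derivative.eval c * (b - a) = f.eval b - f.eval a := by
  have hba : b - a ≠ 0 := (sub_pos.2 hab).ne'
  let q : R[X] := f - C (f.eval a) - C ((f.eval b - f.eval a) / (b - a)) * (X - C a)
  have hder : derivative q = derivative f - C ((f.eval b - f.eval a) / (b - a)) := by
    simp [q]
  have key : ∃ c ∈ Set.Ioo a b, q.derivative.eval c = 0 := by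
    by_cases hq : q = 0
    · obtain ⟨c, hc⟩ := exists_between hab
      exact ⟨c, hc, by simp [hq]⟩
    · refine exists_derivative_eq_zero q hq hab (by simp [q]) ?_
      simp only [q, eval_sub, eval_mul, eval_C, eval_X]
      field_simp
      ring
  obtain ⟨c, hc, h0⟩ := key
  refine ⟨c, hc, ?_⟩
  rw [hder, eval_sub, eval_C, sub_eq_zero] at h0
  rw [h0]
  field_simp

theorem strictMonoOn_eval (f : R[X]) {a b : R}
    (h : ∀ x ∈ Set.Ioo a b, 0 < f.derivative.eval x) :
    StrictMonoOn (fun x => f.eval x) (Set.Icc a b) := by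
  intro x hx y hy hxy
  obtain ⟨c, hc, hc'⟩ := exists_derivative_mul_sub_eq f hxy
  have := mul_pos (h c ⟨hx.1.trans_lt hc.1, hc.2.trans_le hy.2⟩) (sub_pos.2 hxy)
  rw [hc'] at this
  exact sub_pos.1 this

end Order

/-! ### Transporting a root between real closed fields through its cut -/

section Step

variable {F R₁ R₂ : Type u} [Field F] [LinearOrder F]
  [Field R₁] [LinearOrder R₁] [IsStrictOrderedRing R₁]
  [Field R₂] [LinearOrder R₂] [IsStrictOrderedRing R₂]

/-- A root of a monic polynomial is bounded by an element of the ground field. -/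
theorem exists_abs_lt [IsStrictOrderedRing F] (i : F →+* R₁) (hi : StrictMono i) {f : F[X]} (hf : f.Monic)
    {α : R₁} (hα : f.eval₂ i α = 0) : ∃ M : F, |α| < i M := by
  -- A Cauchy bound: if `|α|` reached it, the leading term would dominate all the others.
  let B : F := 1 + ∑ j ∈ Finset.range f.natDegree, |f.coeff j|
  refine ⟨B, ?_⟩
  by_contra hcon
  push Not at hcon
  have habs : ∀ x, |i x| = i |x| := fun x => by
    rcases le_total 0 x with h | h
    · rw [abs_of_nonneg h, abs_of_nonneg (by simpa using hi.monotone h)]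
    · rw [abs_of_nonpos h, abs_of_nonpos (by simpa using hi.monotone h), map_neg]
  have hB : i B = 1 + ∑ j ∈ Finset.range f.natDegree, |i (f.coeff j)| := by
    simp only [B, map_add, map_one, map_sum, habs]
  rw [hB] at hcon
  have hS : 0 ≤ ∑ j ∈ Finset.range f.natDegree, |i (f.coeff j)| :=
    Finset.sum_nonneg fun _ _ => abs_nonneg _
  have h1 : 1 ≤ |α| := by linarith
  have hn : f.natDegree ≠ 0 := by
    intro h0
    rw [hf.natDegree_eq_zero.1 h0] at hα
    simp at hα
  have hpow : α ^ f.natDegree = -∑ j ∈ Finset.range f.natDegree, i (f.coeff j) * α ^ j := by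
    have h2 := hα
    rw [eval₂_eq_sum_range, Finset.sum_range_succ, hf.coeff_natDegree, map_one, one_mul] at h2
    linear_combination h2
  have hle : |α| ^ f.natDegree ≤
      (∑ j ∈ Finset.range f.natDegree, |i (f.coeff j)|) * |α| ^ (f.natDegree - 1) := by
    rw [← abs_pow, hpow, abs_neg, Finset.sum_mul]
    refine (Finset.abs_sum_le_sum_abs _ _).trans (Finset.sum_le_sum fun j hj => ?_)
    rw [abs_mul, abs_pow]
    refine mul_le_mul_of_nonneg_left (pow_le_pow_right₀ h1 ?_) (abs_nonneg _)
    have := Finset.mem_range.1 hj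
    lia
  have hsplit : |α| ^ f.natDegree = |α| * |α| ^ (f.natDegree - 1) := by
    rw [← pow_succ', Nat.sub_add_cancel (Nat.one_le_iff_ne_zero.2 hn)]
  rw [hsplit] at hle
  have hpos : 0 < |α| ^ (f.natDegree - 1) := by positivity
  have := le_of_mul_le_mul_right hle hpos
  linarith

variable [IsIVTField R₁] [IsIVTField R₂] (i₁ : F →+* R₁) (i₂ : F →+* R₂)

theorem mul_pos_iff_of_ne_zero {R : Type u} [Field R] [LinearOrder R] [IsStrictOrderedRing R]
    {x y : R} (hx : x ≠ 0) (hy : y ≠ 0) : 0 < x * y ↔ (0 < x ↔ 0 < y) := by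
  rcases hx.lt_or_gt with h | h <;> rcases hy.lt_or_gt with h' | h' <;>
    simp [h, h', h.not_gt, h'.not_gt, mul_pos_of_neg_of_neg,
      (mul_neg_of_neg_of_pos _ _).not_gt]

/-- In degree below `n` the cut over `F` determines all signs. A root `d` in `F` splits off a factor
`X - d`, whose sign the cut decides. Without roots in `F` there are none in `R₁` or `R₂`, so the
sign is constant and can be read off at `0`. -/
theorem eval₂_pos_iff (h₁ : StrictMono i₁) (h₂ : StrictMono i₂) {n : ℕ}
    (hr₁ : ∀ h : F[X], h ≠ 0 → h.natDegree < n → ∀ x, h.eval₂ i₁ x = 0 → ∃ d, i₁ d = x)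
    (hr₂ : ∀ h : F[X], h ≠ 0 → h.natDegree < n → ∀ x, h.eval₂ i₂ x = 0 → ∃ d, i₂ d = x)
    {α : R₁} {β : R₂} (hα : ∀ d, i₁ d ≠ α) (hβ : ∀ d, i₂ d ≠ β)
    (hcut : ∀ d, i₁ d < α ↔ i₂ d < β) (h : F[X]) (h0 : h ≠ 0) (hdeg : h.natDegree < n) :
    0 < h.eval₂ i₁ α ↔ 0 < h.eval₂ i₂ β := by
  induction hm : h.natDegree using Nat.strong_induction_on generalizing h with
  | _ m ih =>
  subst hm
  by_cases hd : ∃ d, h.eval d = 0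
  · obtain ⟨d, hd⟩ := hd
    obtain ⟨k, rfl⟩ := dvd_iff_isRoot.2 hd
    have hk0 : k ≠ 0 := right_ne_zero_of_mul h0
    have hdeg' : ((X - C d) * k).natDegree = k.natDegree + 1 := by
      rw [natDegree_mul (X_sub_C_ne_zero d) hk0, natDegree_X_sub_C, add_comm]
    have hk : k.natDegree < n := by lia
    have hkα : k.eval₂ i₁ α ≠ 0 := fun e => by
      obtain ⟨d, hd⟩ := hr₁ k hk0 hk _ e
      exact hα d hd
    have hkβ : k.eval₂ i₂ β ≠ 0 := fun e => by
      obtain ⟨d, hd⟩ := hr₂ k hk0 hk _ e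
      exact hβ d hd
    simp only [eval₂_mul, eval₂_sub, eval₂_X, eval₂_C]
    rw [mul_pos_iff_of_ne_zero (sub_ne_zero.2 (hα d).symm) hkα,
      mul_pos_iff_of_ne_zero (sub_ne_zero.2 (hβ d).symm) hkβ, sub_pos, sub_pos, hcut,
      ih _ (by lia) k hk0 hk rfl]
  · have hn₁ : ∀ x, (h.map i₁).eval x ≠ 0 := fun x hx => by
      rw [eval_map] at hx
      obtain ⟨d, rfl⟩ := hr₁ h h0 hdeg x hx
      rw [eval₂_at_apply] at hx
      exact hd ⟨d, i₁.injective (hx.trans (map_zero _).symm)⟩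
    have hn₂ : ∀ x, (h.map i₂).eval x ≠ 0 := fun x hx => by
      rw [eval_map] at hx
      obtain ⟨d, rfl⟩ := hr₂ h h0 hdeg x hx
      rw [eval₂_at_apply] at hx
      exact hd ⟨d, i₂.injective (hx.trans (map_zero _).symm)⟩
    have e₁ := (mul_pos_iff_of_ne_zero (hn₁ _) (hn₁ _)).1
      (eval_mul_eval_pos (h.map i₁) (i₁ 0) α fun c _ => hn₁ c)
    have e₂ := (mul_pos_iff_of_ne_zero (hn₂ _) (hn₂ _)).1
      (eval_mul_eval_pos (h.map i₂) (i₂ 0) β fun c _ => hn₂ c)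
    rw [eval_map, eval_map, eval₂_at_apply] at e₁ e₂
    rw [← e₁, ← e₂, ← map_zero i₁, ← map_zero i₂, h₁.lt_iff_lt, h₂.lt_iff_lt]

/-- As `g` is strictly increasing on both intervals, an element `d` between `a` and `b` lies below
the root exactly when `g.eval d < 0`, a condition in `F` alone. -/
theorem exists_root_same_cut_of_pos (h₁ : StrictMono i₁) (h₂ : StrictMono i₂) (g : F[X])
    {a b : F} (hab : a < b)
    (hd₁ : ∀ x ∈ Set.Ioo (i₁ a) (i₁ b), 0 < (derivative (g.map i₁)).eval x)
    (hd₂ : ∀ x ∈ Set.Ioo (i₂ a) (i₂ b), 0 < (derivative (g.map i₂)).eval x)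
    {α : R₁} (hα : α ∈ Set.Ioo (i₁ a) (i₁ b)) (hgα : g.eval₂ i₁ α = 0) :
    ∃ β, g.eval₂ i₂ β = 0 ∧ ∀ d, i₁ d < α ↔ i₂ d < β := by
  have hev₁ : ∀ d, (g.map i₁).eval (i₁ d) = i₁ (g.eval d) := fun d => by
    rw [eval_map, eval₂_at_apply]
  have hev₂ : ∀ d, (g.map i₂).eval (i₂ d) = i₂ (g.eval d) := fun d => by
    rw [eval_map, eval₂_at_apply]
  have hs₁ : ∀ x, i₁ x < 0 ↔ x < 0 := fun x => by rw [← map_zero i₁, h₁.lt_iff_lt]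
  have hs₂ : ∀ x, i₂ x < 0 ↔ x < 0 := fun x => by rw [← map_zero i₂, h₂.lt_iff_lt]
  have ht₁ : ∀ x, 0 < i₁ x ↔ 0 < x := fun x => by rw [← map_zero i₁, h₁.lt_iff_lt]
  have ht₂ : ∀ x, 0 < i₂ x ↔ 0 < x := fun x => by rw [← map_zero i₂, h₂.lt_iff_lt]
  have m₁ := strictMonoOn_eval (g.map i₁) hd₁
  have m₂ := strictMonoOn_eval (g.map i₂) hd₂
  rw [← eval_map] at hgα
  have hα' : α ∈ Set.Icc (i₁ a) (i₁ b) := ⟨hα.1.le, hα.2.le⟩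
  have ha : g.eval a < 0 := by
    have := m₁ (Set.left_mem_Icc.2 (h₁ hab).le) hα' hα.1
    simp only [hgα, hev₁] at this
    exact (hs₁ _).1 this
  have hb : 0 < g.eval b := by
    have := m₁ hα' (Set.right_mem_Icc.2 (h₁ hab).le) hα.2
    simp only [hgα, hev₁] at this
    exact (ht₁ _).1 this
  obtain ⟨β, hβ, hβ0⟩ := exists_root_mem_Icc (g.map i₂) (h₂ hab).le (by
    rw [hev₂, hev₂]
    exact (mul_neg_of_neg_of_pos ((hs₂ _).2 ha) ((ht₂ _).2 hb)).le)
  have hβa : i₂ a < β := by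
    refine lt_of_le_of_ne hβ.1 ?_
    rintro rfl
    rw [hev₂] at hβ0
    exact ((hs₂ _).2 ha).ne hβ0
  have hβb : β < i₂ b := by
    refine lt_of_le_of_ne hβ.2 ?_
    rintro rfl
    rw [hev₂] at hβ0
    exact ((ht₂ _).2 hb).ne' hβ0
  refine ⟨β, by rw [← eval_map]; exact hβ0, fun d => ?_⟩
  rcases le_or_gt d a with hda | hda
  · exact iff_of_true ((h₁.monotone hda).trans_lt hα.1) ((h₂.monotone hda).trans_lt hβa)
  rcases le_or_gt b d with hdb | hdb
  · exact iff_of_false (hα.2.trans_le (h₁.monotone hdb)).not_gt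
      (hβb.trans_le (h₂.monotone hdb)).not_gt
  rw [← m₁.lt_iff_lt ⟨(h₁ hda).le, (h₁ hdb).le⟩ hα', ← m₂.lt_iff_lt
    ⟨(h₂ hda).le, (h₂ hdb).le⟩ hβ]
  simp only [hgα, hβ0, hev₁, hev₂, hs₁, hs₂]

theorem exists_root_same_cut [IsStrictOrderedRing F] (h₁ : StrictMono i₁) (h₂ : StrictMono i₂) (g : F[X])
    {a b : F} (hab : a < b)
    (hd₁ : ∀ x ∈ Set.Ioo (i₁ a) (i₁ b), (derivative (g.map i₁)).eval x ≠ 0)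
    (hd₂ : ∀ x ∈ Set.Ioo (i₂ a) (i₂ b), (derivative (g.map i₂)).eval x ≠ 0)
    {α : R₁} (hα : α ∈ Set.Ioo (i₁ a) (i₁ b)) (hgα : g.eval₂ i₁ α = 0) :
    ∃ β, g.eval₂ i₂ β = 0 ∧ ∀ d, i₁ d < α ↔ i₂ d < β := by
  -- A sample point in `F`: the sign of the derivative at `m` is its sign on both intervals.
  obtain ⟨m, hm⟩ := exists_between hab
  have hm₁ : i₁ m ∈ Set.Ioo (i₁ a) (i₁ b) := ⟨h₁ hm.1, h₁ hm.2⟩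
  have hm₂ : i₂ m ∈ Set.Ioo (i₂ a) (i₂ b) := ⟨h₂ hm.1, h₂ hm.2⟩
  have hev₁ : (derivative (g.map i₁)).eval (i₁ m) = i₁ ((derivative g).eval m) := by
    rw [derivative_map, eval_map, eval₂_at_apply]
  have hev₂ : (derivative (g.map i₂)).eval (i₂ m) = i₂ ((derivative g).eval m) := by
    rw [derivative_map, eval_map, eval₂_at_apply]
  have hp₁ : ∀ x ∈ Set.Ioo (i₁ a) (i₁ b),
      0 < (derivative (g.map i₁)).eval x * i₁ ((derivative g).eval m) := fun x hx => by
    rw [← hev₁]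
    exact eval_mul_eval_pos _ _ _ fun c hc => hd₁ c (Set.ordConnected_Ioo.uIcc_subset hx hm₁ hc)
  have hp₂ : ∀ x ∈ Set.Ioo (i₂ a) (i₂ b),
      0 < (derivative (g.map i₂)).eval x * i₂ ((derivative g).eval m) := fun x hx => by
    rw [← hev₂]
    exact eval_mul_eval_pos _ _ _ fun c hc => hd₂ c (Set.ordConnected_Ioo.uIcc_subset hx hm₂ hc)
  have hne : (derivative g).eval m ≠ 0 := fun h => hd₁ _ hm₁ (by rw [hev₁, h, map_zero])
  rcases hne.lt_or_gt with hneg | hpos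
  · have hn₁ : i₁ ((derivative g).eval m) < 0 := by
      rw [← map_zero i₁]; exact h₁ hneg
    have hn₂ : i₂ ((derivative g).eval m) < 0 := by
      rw [← map_zero i₂]; exact h₂ hneg
    obtain ⟨β, hβ, hcut⟩ := exists_root_same_cut_of_pos i₁ i₂ h₁ h₂ (-g) hab
      (fun x hx => by
        rw [Polynomial.map_neg, derivative_neg, eval_neg]
        exact neg_pos.2 (neg_of_mul_pos_left (hp₁ x hx) hn₁.le))
      (fun x hx => by
        rw [Polynomial.map_neg, derivative_neg, eval_neg]
        exact neg_pos.2 (neg_of_mul_pos_left (hp₂ x hx) hn₂.le))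
      hα (by rw [eval₂_neg, hgα, neg_zero])
    exact ⟨β, by rwa [eval₂_neg, neg_eq_zero] at hβ, hcut⟩
  · have hn₁ : 0 < i₁ ((derivative g).eval m) := by
      rw [← map_zero i₁]; exact h₁ hpos
    have hn₂ : 0 < i₂ ((derivative g).eval m) := by
      rw [← map_zero i₂]; exact h₂ hpos
    exact exists_root_same_cut_of_pos i₁ i₂ h₁ h₂ g hab
      (fun x hx => pos_of_mul_pos_left (hp₁ x hx) hn₁.le)
      (fun x hx => pos_of_mul_pos_left (hp₂ x hx) hn₂.le) hα hgα

/-- A simple extension of the ordered field `F` of minimal degree inside `R₁` embeds into `R₂`. -/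
theorem exists_root_forall_nonneg_iff [IsStrictOrderedRing F] (h₁ : StrictMono i₁) (h₂ : StrictMono i₂)
    {f : F[X]} (hf : Irreducible f) (hmonic : f.Monic)
    (hr₁ : ∀ h : F[X], h ≠ 0 → h.natDegree < f.natDegree → ∀ x, h.eval₂ i₁ x = 0 → ∃ d, i₁ d = x)
    (hr₂ : ∀ h : F[X], h ≠ 0 → h.natDegree < f.natDegree → ∀ x, h.eval₂ i₂ x = 0 → ∃ d, i₂ d = x)
    {α : R₁} (hα : ∀ d, i₁ d ≠ α) (hfα : f.eval₂ i₁ α = 0) :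
    ∃ β, ∀ h : F[X], 0 ≤ h.eval₂ i₁ α ↔ 0 ≤ h.eval₂ i₂ β := by
  classical
  have hn : 0 < f.natDegree := hf.natDegree_pos
  have hder0 : derivative f ≠ 0 := fun h => hn.ne' (derivative_eq_zero.1 h)
  have hderlt : (derivative f).natDegree < f.natDegree := natDegree_derivative_lt hn.ne'
  obtain ⟨M, hM⟩ := exists_abs_lt i₁ h₁ hmonic hfα
  rw [abs_lt] at hM
  let Z := (derivative f).roots.toFinset
  have hZ : ∀ d, d ∈ Z ↔ (derivative f).eval d = 0 := fun d => by simp [Z, hder0]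
  -- The points `a` and `b` are the roots of `f'` in `F` nearest to `α` within the bounds `-M` and
  -- `M`, or these bounds themselves. By minimality of the degree, `f'` has no other roots in `R₁`
  -- or `R₂`, so it vanishes nowhere between `a` and `b`.
  obtain ⟨a, ha, hamax⟩ := (insert (-M) (Z.filter fun d => i₁ d < α)).exists_max_image id
    ⟨_, Finset.mem_insert_self _ _⟩
  obtain ⟨b, hb, hbmin⟩ := (insert M (Z.filter fun d => α < i₁ d)).exists_min_image id
    ⟨_, Finset.mem_insert_self _ _⟩
  have haα : i₁ a < α := by
    rcases Finset.mem_insert.1 ha with rfl | h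
    · rw [map_neg]; exact hM.1
    · exact (Finset.mem_filter.1 h).2
  have hbα : α < i₁ b := by
    rcases Finset.mem_insert.1 hb with rfl | h
    · exact hM.2
    · exact (Finset.mem_filter.1 h).2
  have hab : a < b := h₁.lt_iff_lt.1 (haα.trans hbα)
  have hno : ∀ d, a < d → d < b → (derivative f).eval d ≠ 0 := by
    intro d had hdb h0
    rcases (hα d).lt_or_gt with h | h
    · exact absurd (hamax d (Finset.mem_insert_of_mem (Finset.mem_filter.2 ⟨(hZ d).2 h0, h⟩)))
        (not_le.2 had)
    · exact absurd (hbmin d (Finset.mem_insert_of_mem (Finset.mem_filter.2 ⟨(hZ d).2 h0, h⟩)))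
        (not_le.2 hdb)
  have hd₁ : ∀ x ∈ Set.Ioo (i₁ a) (i₁ b), (derivative (f.map i₁)).eval x ≠ 0 := by
    intro x hx h0
    rw [derivative_map, eval_map] at h0
    obtain ⟨d, rfl⟩ := hr₁ _ hder0 hderlt x h0
    rw [eval₂_at_apply] at h0
    exact hno d (h₁.lt_iff_lt.1 hx.1) (h₁.lt_iff_lt.1 hx.2)
      (i₁.injective (h0.trans (map_zero _).symm))
  have hd₂ : ∀ x ∈ Set.Ioo (i₂ a) (i₂ b), (derivative (f.map i₂)).eval x ≠ 0 := by
    intro x hx h0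
    rw [derivative_map, eval_map] at h0
    obtain ⟨d, rfl⟩ := hr₂ _ hder0 hderlt x h0
    rw [eval₂_at_apply] at h0
    exact hno d (h₂.lt_iff_lt.1 hx.1) (h₂.lt_iff_lt.1 hx.2)
      (i₂.injective (h0.trans (map_zero _).symm))
  obtain ⟨β, hfβ, hcut⟩ := exists_root_same_cut i₁ i₂ h₁ h₂ f hab hd₁ hd₂ ⟨haα, hbα⟩ hfα
  -- A root of the irreducible `f` in `F` would make `f` linear and put `α` in `F`.
  have hβ : ∀ d, i₂ d ≠ β := by
    rintro d rfl
    rw [eval₂_at_apply] at hfβ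
    have hd : f.eval d = 0 := i₂.injective (hfβ.trans (map_zero _).symm)
    obtain ⟨k, hk⟩ := dvd_iff_isRoot.2 hd
    have hku : IsUnit k := (hf.isUnit_or_isUnit hk).resolve_left (not_isUnit_X_sub_C d)
    obtain ⟨κ, hκ, rfl⟩ := isUnit_iff.1 hku
    rw [hk, eval₂_mul, eval₂_sub, eval₂_X, eval₂_C, eval₂_C] at hfα
    have hκ0 : i₁ κ ≠ 0 := (map_ne_zero i₁).2 hκ.ne_zero
    exact hα d (sub_eq_zero.1 ((mul_eq_zero.1 hfα).resolve_right hκ0)).symm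
  refine ⟨β, fun h => ?_⟩
  have e₁ : h.eval₂ i₁ α = (h %ₘ f).eval₂ i₁ α := by
    conv_lhs => rw [← modByMonic_add_div h f]
    rw [eval₂_add, eval₂_mul, hfα, zero_mul, add_zero]
  have e₂ : h.eval₂ i₂ β = (h %ₘ f).eval₂ i₂ β := by
    conv_lhs => rw [← modByMonic_add_div h f]
    rw [eval₂_add, eval₂_mul, hfβ, zero_mul, add_zero]
  rw [e₁, e₂]
  by_cases h0 : h %ₘ f = 0
  · simp [h0]
  have hlt : (h %ₘ f).natDegree < f.natDegree := natDegree_modByMonic_lt h hmonic (by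
    rintro rfl
    simp at hn)
  have hne₁ : (h %ₘ f).eval₂ i₁ α ≠ 0 := fun e => by
    obtain ⟨d, hd⟩ := hr₁ _ h0 hlt _ e
    exact hα d hd
  have hne₂ : (h %ₘ f).eval₂ i₂ β ≠ 0 := fun e => by
    obtain ⟨d, hd⟩ := hr₂ _ h0 hlt _ e
    exact hβ d hd
  rw [hne₁.symm.le_iff_lt, hne₂.symm.le_iff_lt]
  exact eval₂_pos_iff i₁ i₂ h₁ h₂ hr₁ hr₂ hα hβ hcut _ h0 hlt

end Step

end IsIVTField

namespace IsIVTField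

open Polynomial

section Larger

variable {F R₁ R₂ : Type u} [Field F] [LinearOrder F] [IsStrictOrderedRing F]
  [Field R₁] [LinearOrder R₁] [IsStrictOrderedRing R₁] [IsIVTField R₁]
  [Field R₂] [LinearOrder R₂] [IsStrictOrderedRing R₂] [IsIVTField R₂]
  (i₁ : F →+* R₁) (i₂ : F →+* R₂)

/-- An isomorphism between ordered subfields of two real closed fields algebraic over them extends
to a proper extension of one of these subfields. -/
theorem exists_larger_subring (h₁ : StrictMono i₁) (h₂ : StrictMono i₂) (hintegral₁ : i₁.IsIntegral)
    (hintegral₂ : i₂.IsIntegral) (hns : ¬ (Function.Surjective i₁ ∧ Function.Surjective i₂)) :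
    ∃ S : Subring (R₁ × R₂), (i₁.prod i₂).range < S ∧ ∀ z ∈ S, (0 ≤ z.1 ↔ 0 ≤ z.2) := by
  classical
  suffices key : ∃ (α : R₁) (β : R₂), ((∀ d, i₁ d ≠ α) ∨ (∀ d, i₂ d ≠ β)) ∧
      ∀ h : F[X], 0 ≤ h.eval₂ i₁ α ↔ 0 ≤ h.eval₂ i₂ β by
    obtain ⟨α, β, hout, hsgn⟩ := key
    have e₁ : ∀ h : F[X], (h.eval₂ (i₁.prod i₂) (α, β)).1 = h.eval₂ i₁ α := fun h =>
      hom_eval₂ h (i₁.prod i₂) (RingHom.fst R₁ R₂) (α, β)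
    have e₂ : ∀ h : F[X], (h.eval₂ (i₁.prod i₂) (α, β)).2 = h.eval₂ i₂ β := fun h =>
      hom_eval₂ h (i₁.prod i₂) (RingHom.snd R₁ R₂) (α, β)
    refine ⟨(eval₂RingHom (i₁.prod i₂) (α, β)).range, ?_, ?_⟩
    · refine SetLike.lt_iff_le_and_exists.2 ⟨?_, (α, β), RingHom.mem_range.2 ⟨X, by simp⟩, ?_⟩
      · rintro _ ⟨d, rfl⟩
        exact ⟨C d, by simp⟩
      · rintro ⟨d, hd⟩
        have hd' : i₁ d = α ∧ i₂ d = β := Prod.ext_iff.1 hd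
        exact hout.elim (fun h => h d hd'.1) (fun h => h d hd'.2)
    · rintro _ ⟨h, rfl⟩
      rw [coe_eval₂RingHom, e₁, e₂]
      exact hsgn h
  -- The minimum is taken over both fields at once: below it, all roots in `R₁` and in `R₂` come
  -- from `F`, as the cut argument requires.
  let bad : ℕ → Prop := fun n => ∃ h : F[X], h ≠ 0 ∧ h.natDegree = n ∧
    ((∃ x, h.eval₂ i₁ x = 0 ∧ ∀ d, i₁ d ≠ x) ∨ ∃ x, h.eval₂ i₂ x = 0 ∧ ∀ d, i₂ d ≠ x)
  have hbad : ∃ n, bad n := by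
    rw [not_and_or] at hns
    rcases hns with hns | hns
    · rw [Function.Surjective] at hns
      push Not at hns
      obtain ⟨x, hx⟩ := hns
      obtain ⟨p, hp, hpx⟩ := hintegral₁ x
      exact ⟨_, p, hp.ne_zero, rfl, Or.inl ⟨x, hpx, hx⟩⟩
    · rw [Function.Surjective] at hns
      push Not at hns
      obtain ⟨x, hx⟩ := hns
      obtain ⟨p, hp, hpx⟩ := hintegral₂ x
      exact ⟨_, p, hp.ne_zero, rfl, Or.inr ⟨x, hpx, hx⟩⟩
  have hmin : ∀ m < Nat.find hbad, ¬ bad m := fun m hm => Nat.find_min hbad hm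
  have hr₁ : ∀ h : F[X], h ≠ 0 → h.natDegree < Nat.find hbad → ∀ x, h.eval₂ i₁ x = 0 →
      ∃ d, i₁ d = x := fun h h0 hlt x hx => by
    by_contra hcon
    push Not at hcon
    exact hmin _ hlt ⟨h, h0, rfl, Or.inl ⟨x, hx, hcon⟩⟩
  have hr₂ : ∀ h : F[X], h ≠ 0 → h.natDegree < Nat.find hbad → ∀ x, h.eval₂ i₂ x = 0 →
      ∃ d, i₂ d = x := fun h h0 hlt x hx => by
    by_contra hcon
    push Not at hcon
    exact hmin _ hlt ⟨h, h0, rfl, Or.inr ⟨x, hx, hcon⟩⟩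
  obtain ⟨h, h0, hdeg, hx⟩ := Nat.find_spec hbad
  have hminpoly : ∀ {R : Type u} [Field R] (i : F →+* R) (hintegral : i.IsIntegral) (x : R),
      h.eval₂ i x = 0 → ∃ f : F[X], Irreducible f ∧ f.Monic ∧ f.eval₂ i x = 0 ∧
        f.natDegree ≤ Nat.find hbad := by
    intro R _ i hintegral x hx
    let : Algebra F R := i.toAlgebra
    have hxi : IsIntegral F x := hintegral x
    refine ⟨minpoly F x, minpoly.irreducible hxi, minpoly.monic hxi, minpoly.aeval F x, ?_⟩
    rw [← hdeg]
    exact natDegree_le_natDegree (minpoly.degree_le_of_ne_zero F x h0 hx)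
  rcases hx with ⟨x, hx, hout⟩ | ⟨x, hx, hout⟩
  · obtain ⟨f, hirr, hmonic, hfx, hle⟩ := hminpoly i₁ hintegral₁ x hx
    obtain ⟨β, hβ⟩ := exists_root_forall_nonneg_iff i₁ i₂ h₁ h₂ hirr hmonic
      (fun h h0 hlt => hr₁ h h0 (hlt.trans_le hle))
      (fun h h0 hlt => hr₂ h h0 (hlt.trans_le hle)) hout hfx
    exact ⟨x, β, Or.inl hout, hβ⟩
  · obtain ⟨f, hirr, hmonic, hfx, hle⟩ := hminpoly i₂ hintegral₂ x hx
    obtain ⟨α, hα⟩ := exists_root_forall_nonneg_iff i₂ i₁ h₂ h₁ hirr hmonic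
      (fun h h0 hlt => hr₂ h h0 (hlt.trans_le hle))
      (fun h h0 hlt => hr₁ h h0 (hlt.trans_le hle)) hout hfx
    exact ⟨α, x, Or.inr hout, fun h => (hα h).symm⟩

end Larger

/-- The orderings pulled back from `R₁` and `R₂` agree, so `G` becomes an ordered field with both
maps strictly increasing. -/
theorem exists_larger_subring_of_nonneg_iff {G R₁ R₂ : Type u} [Field G]
    [Field R₁] [LinearOrder R₁] [IsStrictOrderedRing R₁] [IsIVTField R₁]
    [Field R₂] [LinearOrder R₂] [IsStrictOrderedRing R₂] [IsIVTField R₂]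
    (i₁ : G →+* R₁) (i₂ : G →+* R₂) (hsgn : ∀ z, 0 ≤ i₁ z ↔ 0 ≤ i₂ z) (hintegral₁ : i₁.IsIntegral)
    (hintegral₂ : i₂.IsIntegral) (hns : ¬ (Function.Surjective i₁ ∧ Function.Surjective i₂)) :
    ∃ S : Subring (R₁ × R₂), (i₁.prod i₂).range < S ∧ ∀ z ∈ S, (0 ≤ z.1 ↔ 0 ≤ z.2) := by
  have hcone : IsPositiveCone {z : G | 0 ≤ i₁ z} :=
    { add_mem := fun {z w} hz hw => by
        change 0 ≤ i₁ (z + w)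
        rw [map_add]; exact add_nonneg hz hw
      mul_mem := fun {z w} hz hw => by
        change 0 ≤ i₁ (z * w)
        rw [map_mul]; exact mul_nonneg hz hw
      mul_self_mem := fun z => by
        change 0 ≤ i₁ (z * z)
        rw [map_mul]; exact mul_self_nonneg _
      eq_zero := fun {z} hz hw => by
        change 0 ≤ i₁ (-z) at hw
        rw [map_neg] at hw
        exact i₁.injective ((le_antisymm (neg_nonneg.1 hw) hz : i₁ z = 0).trans (map_zero i₁).symm) }
  have htot : ∀ z : G, z ∈ {z : G | 0 ≤ i₁ z} ∨ -z ∈ {z : G | 0 ≤ i₁ z} := fun z => by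
    change 0 ≤ i₁ z ∨ 0 ≤ i₁ (-z)
    rw [map_neg, neg_nonneg]
    exact le_total _ _
  let : LinearOrder G := hcone.linearOrder htot
  have : IsStrictOrderedRing G := hcone.isStrictOrderedRing htot
  have hnn : ∀ z : G, 0 ≤ z ↔ 0 ≤ i₁ z := fun z => hcone.nonneg_iff
  have hnn₂ : ∀ z : G, 0 ≤ z ↔ 0 ≤ i₂ z := fun z => (hnn z).trans (hsgn z)
  have hm₁ : StrictMono i₁ := by
    refine Monotone.strictMono_of_injective (fun z w hzw => ?_) i₁.injective
    have := (hnn _).1 (sub_nonneg.2 hzw)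
    rwa [map_sub, sub_nonneg] at this
  have hm₂ : StrictMono i₂ := by
    refine Monotone.strictMono_of_injective (fun z w hzw => ?_) i₂.injective
    have := (hnn₂ _).1 (sub_nonneg.2 hzw)
    rwa [map_sub, sub_nonneg] at this
  exact exists_larger_subring i₁ i₂ hm₁ hm₂ hintegral₁ hintegral₂ hns

/-- The ordering of a real closed field. -/
noncomputable abbrev linearOrder (R : Type u) [Field R] [IsIVTField R] : LinearOrder R :=
  (isPositiveCone_isSquare R).linearOrder isSquare_or_isSquare_neg

theorem isStrictOrderedRing (R : Type u) [Field R] [IsIVTField R] :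
    @IsStrictOrderedRing R _ (linearOrder R).toPartialOrder :=
  (isPositiveCone_isSquare R).isStrictOrderedRing isSquare_or_isSquare_neg

/-- Uniqueness of real closures: two algebraic extensions of a field by real closed fields which
induce the same ordering are isomorphic. -/
theorem exists_ringHom {K R₁ R₂ : Type u} [Field K] [Field R₁] [IsIVTField R₁] [Field R₂]
    [IsIVTField R₂] (φ₁ : K →+* R₁) (φ₂ : K →+* R₂) (hintegral₁ : φ₁.IsIntegral)
    (hintegral₂ : φ₂.IsIntegral) (hsq : ∀ x, IsSquare (φ₁ x) ↔ IsSquare (φ₂ x)) :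
    ∃ ψ : R₂ →+* R₁, ∀ x, ψ (φ₂ x) = φ₁ x := by
  let : LinearOrder R₁ := linearOrder R₁
  let : LinearOrder R₂ := linearOrder R₂
  have : IsStrictOrderedRing R₁ := isStrictOrderedRing R₁
  have : IsStrictOrderedRing R₂ := isStrictOrderedRing R₂
  -- Graphs of order-preserving partial isomorphisms over `K`.
  let T : Set (Subring (R₁ × R₂)) :=
    {G | (φ₁.prod φ₂).range ≤ G ∧ ∀ z ∈ G, (0 ≤ z.1 ↔ 0 ≤ z.2)}
  obtain ⟨G, -, hG⟩ : ∃ G, (φ₁.prod φ₂).range ≤ G ∧ Maximal (· ∈ T) G := by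
    refine zorn_le_nonempty₀ T (fun c hc hchain y hy => ?_) _ ⟨le_rfl, ?_⟩
    · refine ⟨sSup c, ⟨(hc hy).1.trans (le_sSup hy), fun z hz => ?_⟩, fun z hz => le_sSup hz⟩
      obtain ⟨G, hG, hz⟩ := (Subring.mem_sSup_of_directedOn ⟨y, hy⟩ hchain.directedOn).1 hz
      exact (hc hG).2 z hz
    · rintro _ ⟨x, rfl⟩
      change 0 ≤ φ₁ x ↔ 0 ≤ φ₂ x
      rw [← isSquare_iff_nonneg, ← isSquare_iff_nonneg]
      exact hsq x
  obtain ⟨hGK, hGsgn⟩ := hG.prop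
  -- Agreement of signs for `z` and `-z` makes the first projection injective. So `G` is a domain
  -- integral over `K`, hence a field.
  have hfst : ∀ z : G, z.1.1 = 0 → z = 0 := fun z hz => by
    refine Subtype.ext (Prod.ext hz (le_antisymm ?_ ((hGsgn z.1 z.2).1 hz.ge)))
    have := (hGsgn (-z).1 (-z).2).1 (by
      change 0 ≤ -z.1.1
      rw [hz, neg_zero])
    exact neg_nonneg.1 this
  have : Nontrivial G := ⟨0, 1, fun h => zero_ne_one
    (congrArg (fun z : G => z.1.1) h : (0 : R₁) = 1)⟩
  have : NoZeroDivisors G := ⟨fun {z w} h => by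
    have : z.1.1 * w.1.1 = 0 := congrArg (fun z : G => z.1.1) h
    exact (mul_eq_zero.1 this).imp (hfst z) (hfst w)⟩
  have : IsDomain G := NoZeroDivisors.to_isDomain G
  let κ : K →+* G := (φ₁.prod φ₂).codRestrict G fun x => hGK ⟨x, rfl⟩
  have hκ : κ.IsIntegral := fun z => by
    obtain ⟨p, hp, hpz⟩ := hintegral₁ z.1.1
    obtain ⟨q, hq, hqz⟩ := hintegral₂ z.1.2
    refine ⟨p * q, hp.mul hq, Subtype.ext (Prod.ext ?_ ?_)⟩
    · refine (hom_eval₂ (p * q) κ ((RingHom.fst R₁ R₂).comp G.subtype) z).trans ?_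
      change eval₂ φ₁ z.1.1 (p * q) = 0
      rw [eval₂_mul, hpz, zero_mul]
    · refine (hom_eval₂ (p * q) κ ((RingHom.snd R₁ R₂).comp G.subtype) z).trans ?_
      change eval₂ φ₂ z.1.2 (p * q) = 0
      rw [eval₂_mul, hqz, mul_zero]
  have hfield : IsField G := by
    let : Algebra K G := κ.toAlgebra
    have : Algebra.IsIntegral K G := ⟨hκ⟩
    exact isField_of_isIntegral_of_isField' (Field.toIsField K)
  let : Field G := hfield.toField
  let i₁ : G →+* R₁ := (RingHom.fst R₁ R₂).comp G.subtype
  let i₂ : G →+* R₂ := (RingHom.snd R₁ R₂).comp G.subtype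
  have hi₁ : i₁.IsIntegral := RingHom.IsIntegral.tower_top κ i₁ hintegral₁
  have hi₂ : i₂.IsIntegral := RingHom.IsIntegral.tower_top κ i₂ hintegral₂
  have hsurj : Function.Surjective i₁ ∧ Function.Surjective i₂ := by
    by_contra hns
    obtain ⟨S, hS, hSsgn⟩ := exists_larger_subring_of_nonneg_iff i₁ i₂
      (fun z => hGsgn z.1 z.2) hi₁ hi₂ hns
    have hGS : G ≤ S := fun z hz => hS.le ⟨⟨z, hz⟩, rfl⟩
    have hSG : S ≤ G := hG.le_of_ge ⟨hGK.trans hGS, hSsgn⟩ hGS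
    obtain ⟨z, hz, hz'⟩ := SetLike.exists_of_lt hS
    exact hz' ⟨⟨z, hSG hz⟩, rfl⟩
  let e : G ≃+* R₂ := RingEquiv.ofBijective i₂ ⟨i₂.injective, hsurj.2⟩
  refine ⟨i₁.comp (e.symm : R₂ →+* G), fun x => ?_⟩
  have : e.symm (φ₂ x) = κ x := e.symm_apply_eq.2 rfl
  change i₁ (e.symm (φ₂ x)) = φ₁ x
  rw [this]
  rfl

end IsIVTField

/-! ### Comparison of real closures `*` -/

/-- A homomorphism into a real closed field defines a point of the real spectrum. -/
theorem exists_realSpectrum {A L : Type u} [CommRing A] [PartialOrder A] [Field L] [IsIVTField L]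
    (φ : A →+* L) (hφ : ∀ a, 0 ≤ a → IsSquare (φ a)) :
    ∃ α : RealSpectrum A, (∀ a, a ∈ α.cone ↔ IsSquare (φ a)) ∧
      ∀ a, a ∈ α.supp.asIdeal ↔ φ a = 0 := by
  let P : RingPreordering A := RingPreordering.mk' {a | IsSquare (φ a)}
    (fun {x y} hx hy => by
      change IsSquare (φ (x + y))
      rw [map_add]; exact IsIVTField.isSquare_add hx hy)
    (fun {x y} hx hy => by
      change IsSquare (φ (x * y))
      rw [map_mul]; exact IsSquare.mul hx hy)
    (fun x => ⟨φ x, map_mul _ _ _⟩)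
    (fun h => IsIVTField.not_isSquare_neg_one (R := L) (by
      change IsSquare (φ (-1)) at h
      rwa [map_neg, map_one] at h))
  have hP : ∀ a, a ∈ P ↔ IsSquare (φ a) := fun a => Iff.rfl
  have : HasMemOrNegMem P := ⟨fun a => by
    rw [hP, hP, map_neg]
    exact IsIVTField.isSquare_or_isSquare_neg _⟩
  have hsupp : ∀ a, a ∈ P.support ↔ φ a = 0 := fun a => by
    rw [RingPreordering.mem_support, hP, hP, map_neg]
    exact ⟨fun h => IsIVTField.eq_zero h.1 h.2, fun h => by simp [h]⟩
  have hord : P.IsOrdering := RingPreordering.IsOrdering.mk' P fun {x y} h => by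
    rw [hsupp, map_mul, mul_eq_zero] at h
    rwa [hsupp, hsupp]
  exact ⟨⟨P, hord, hφ⟩, fun a => Iff.rfl, hsupp⟩

namespace IsRealClosedStar

variable {C : Type u} [CommRing C] [PartialOrder C]

theorem exists_isIVTField_quotient (hC : IsRealClosedStar C) (hCr : IsVonNeumannRegular C)
    (y : Ideal C) [y.IsPrime] : ∃ (L : Type u) (_ : Field L) (_ : IsIVTField L) (π : C →+* L),
      Function.Surjective π ∧ (∀ c, π c = 0 ↔ c ∈ y) := by
  have : y.IsMaximal := hCr.isMaximal_of_isPrime y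
  let : Field (C ⧸ y) := Ideal.Quotient.field y
  exact ⟨C ⧸ y, inferInstance,
    hC.isIVTField_quotient hCr (Ideal.Quotient.mk y) Ideal.Quotient.mk_surjective,
    Ideal.Quotient.mk y, Ideal.Quotient.mk_surjective, fun c => Ideal.Quotient.eq_zero_iff_mem⟩

/-- The idempotent supported on the set where an element is negative. -/
theorem exists_idempotent_neg (hC : IsRealClosedStar C) (hCr : IsVonNeumannRegular C) (a : C) :
    ∃ n w : C, n * n = n ∧ n = w * a ∧ IsSquare ((1 - n) * a) ∧ IsSquare (-(n * a)) := by
  obtain ⟨g, hg, h1, h2⟩ := hC.exists_idempotent_isSquare hCr a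
  obtain ⟨b, hb, hba⟩ := hCr.exists_idempotent a
  refine ⟨(1 - g) * (a * b), (1 - g) * b, ?_, by ring, ?_, ?_⟩
  · linear_combination (1 - g) * (1 - g) * hb + a * b * hg
  · have : (1 - (1 - g) * (a * b)) * a = g * a := by linear_combination -(1 - g) * hba
    rwa [this]
  · have : (1 - g) * (a * b) * a = (1 - g) * a := by linear_combination (1 - g) * hba
    rwa [this]

end IsRealClosedStar

section Compare

variable {A C D : Type u} [CommRing A] [CommRing C] [PartialOrder C] [CommRing D] [PartialOrder D]

/-- If `C` and `D` induce the same ordering of `A`, every residue field of `C` induces the same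
ordering of `A` as some residue field of `D`. -/
theorem exists_isMaximal_isSquare (hA : IsVonNeumannRegular A)
    (hC : IsRealClosedStar C) (hCr : IsVonNeumannRegular C)
    (hD : IsRealClosedStar D) (hDr : IsVonNeumannRegular D) {f : A →+* C} {g : A →+* D}
    (hf : IsEssentialExtension f) (hg : Function.Injective g)
    (hfg : ∀ a, IsSquare (f a) → IsSquare (g a)) {L : Type u} [Field L] [IsIVTField L]
    (π : C →+* L) : ∃ z : Ideal D, z.IsMaximal ∧
      ∀ a, IsSquare (π (f a)) → IsSquare (Ideal.Quotient.mk z (g a)) := by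
  choose nD wD hnD hwD hposD hnegD using hD.exists_idempotent_neg hDr
  -- Modulo a maximal ideal containing `I`, every `a` that is nonnegative at `π` becomes a square.
  let I : Ideal D := Ideal.span {d | ∃ a, IsSquare (π (f a)) ∧ d = nD (g a)}
  -- Each element of `I` vanishes on the part of `D` lying over a neighbourhood `h` of `π`, tested
  -- by idempotents `e` of `A` below `h`. For a generator, `h` is the locus where `f a` is not
  -- negative; there `a * e` is a square in `C`, hence in `D`.
  have hann : ∀ i ∈ I, ∃ h : C, h * h = h ∧ π h = 1 ∧
      ∀ e : A, e * e = e → h * f e = f e → g e * i = 0 := by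
    intro i hi
    induction hi using Submodule.span_induction with
    | mem i hi =>
      obtain ⟨a, ha, rfl⟩ := hi
      obtain ⟨n, w, hn, hw, hpos, hneg⟩ := hC.exists_idempotent_neg hCr (f a)
      have hπn : π n = 0 := by
        have h1 : π n * (π n - 1) = 0 := by
          rw [mul_sub, ← map_mul, hn, mul_one, sub_self]
        rcases mul_eq_zero.1 h1 with h | h
        · exact h
        · have h2 := hneg.map π
          rw [map_neg, map_mul, sub_eq_zero.1 h, one_mul] at h2
          rw [hw, map_mul, IsIVTField.eq_zero ha h2, mul_zero]
      refine ⟨1 - n, by linear_combination hn, by rw [map_sub, map_one, hπn, sub_zero], fun e he hne => ?_⟩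
      have hge : g e * g e = g e := by rw [← map_mul, he]
      have hsq : IsSquare (g (a * e)) := by
        refine hfg _ ?_
        have h3 : f (a * e) = (1 - n) * f a * f e := by
          rw [map_mul]; linear_combination -(f a) * hne
        rw [h3]
        exact hpos.mul ⟨f e, by rw [← map_mul, he]⟩
      have h4 : nD (g a) * g (a * e) = 0 := by
        refine (hD.isPositiveCone_isSquare hDr).eq_zero
          (IsSquare.mul ⟨nD (g a), (hnD _).symm⟩ hsq) ?_
        have h5 : -(nD (g a) * g (a * e)) = -(nD (g a) * g a) * g e := by
          rw [map_mul]; ring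
        change IsSquare _
        rw [h5]
        exact (hnegD _).mul ⟨g e, hge.symm⟩
      rw [map_mul] at h4
      linear_combination -(g e) * hnD (g a) + g e * nD (g a) * hwD (g a) + wD (g a) * h4
    | zero => exact ⟨1, one_mul 1, map_one _, fun e _ _ => mul_zero _⟩
    | add i j _ _ hi hj =>
      obtain ⟨h, hid, hh, hhe⟩ := hi
      obtain ⟨k, kid, hk, hke⟩ := hj
      refine ⟨h * k, by linear_combination k * k * hid + h * kid, by rw [map_mul, hh, hk, one_mul],
        fun e he hne => ?_⟩
      rw [mul_add, hhe e he (by linear_combination (1 - h) * hne + k * f e * hid),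
        hke e he (by linear_combination (1 - k) * hne + h * f e * kid), add_zero]
    | smul d i _ hi =>
      obtain ⟨h, hid, hh, hhe⟩ := hi
      exact ⟨h, hid, hh, fun e he hne => by rw [smul_eq_mul, mul_left_comm, hhe e he hne, mul_zero]⟩
  have hI : I ≠ ⊤ := by
    intro htop
    obtain ⟨h, hid, hh, hhe⟩ := hann 1 (htop ▸ Submodule.mem_top)
    have hh0 : h ≠ 0 := by rintro rfl; simp at hh
    -- Essentiality puts a nonzero idempotent `a * b` of `A` below `h`; if `1 ∈ I`, this idempotent
    -- would die in `D`.
    obtain ⟨c, a, ha, hca⟩ := ((isEssentialExtension_iff f).1 hf).2 h hh0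
    obtain ⟨b, hb, hba⟩ := hA.exists_idempotent a
    have h1 := hhe (a * b) hb (by
      rw [map_mul, ← hca]; linear_combination c * f b * hid)
    rw [mul_one] at h1
    have h2 : a * b = 0 := hg (h1.trans (map_zero g).symm)
    rw [h2, zero_mul] at hba
    exact ha hba.symm
  obtain ⟨z, hz, hIz⟩ := Ideal.exists_le_maximal I hI
  refine ⟨z, hz, fun a ha => ?_⟩
  have h1 : nD (g a) ∈ z := hIz (Ideal.subset_span ⟨a, ha, rfl⟩)
  have h2 := (hposD (g a)).map (Ideal.Quotient.mk z)
  rwa [map_mul, map_sub, map_one, Ideal.Quotient.eq_zero_iff_mem.2 h1, sub_zero, one_mul] at h2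

/-- If `C` and `D` induce the same ordering of `A`, every residue map of `C` is dominated by a
homomorphism of `D` over `A`. -/
theorem exists_ringHom_residue (hA : IsVonNeumannRegular A)
    (hC : IsRealClosedStar C) (hCr : IsVonNeumannRegular C)
    (hD : IsRealClosedStar D) (hDr : IsVonNeumannRegular D) {f : A →+* C} {g : A →+* D}
    (hf : IsEssentialExtension f) (hg : Function.Injective g)
    (hfi : f.IsIntegral) (hgi : g.IsIntegral)
    (hfg : ∀ a, IsSquare (f a) → IsSquare (g a)) (y : PrimeSpectrum C) :
    ∃ (L : Type u) (_ : Field L) (_ : IsIVTField L) (π : C →+* L) (ψ : D →+* L),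
      (∀ c, π c = 0 ↔ c ∈ y.asIdeal) ∧ ∀ a, ψ (g a) = π (f a) := by
  obtain ⟨L, _, _, π, hπ, hπy⟩ := hC.exists_isIVTField_quotient hCr y.asIdeal
  obtain ⟨z, hz, hzsq⟩ := exists_isMaximal_isSquare hA hC hCr hD hDr hf hg hfg π
  let : Field (D ⧸ z) := Ideal.Quotient.field z
  have : IsIVTField (D ⧸ z) :=
    hD.isIVTField_quotient hDr (Ideal.Quotient.mk z) Ideal.Quotient.mk_surjective
  let p : Ideal A := RingHom.ker (π.comp f)
  have hp : p.IsPrime := RingHom.ker_isPrime _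
  have : p.IsMaximal := hA.isMaximal_of_isPrime p
  let : Field (A ⧸ p) := Ideal.Quotient.field p
  let φ₁ : A ⧸ p →+* L := RingHom.kerLift (π.comp f)
  -- Well defined: for `a ∈ p` both `a` and `-a` become squares modulo `z`.
  let φ₂ : A ⧸ p →+* D ⧸ z := Ideal.Quotient.lift p ((Ideal.Quotient.mk z).comp g) fun a ha => by
    have h0 : π (f a) = 0 := ha
    refine IsIVTField.eq_zero (hzsq a (by simp [h0])) ?_
    have := hzsq (-a) (by simp [h0])
    rwa [map_neg, map_neg] at this
  have h₁ : ∀ a, φ₁ (Ideal.Quotient.mk p a) = π (f a) := fun a => rfl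
  have h₂ : ∀ a, φ₂ (Ideal.Quotient.mk p a) = Ideal.Quotient.mk z (g a) := fun a => rfl
  have hi₁ : φ₁.IsIntegral := RingHom.IsIntegral.tower_top (Ideal.Quotient.mk p) φ₁
    (hfi.trans f π (RingHom.isIntegral_of_surjective π hπ))
  have hi₂ : φ₂.IsIntegral := RingHom.IsIntegral.tower_top (Ideal.Quotient.mk p) φ₂
    (hgi.trans g _ (RingHom.isIntegral_of_surjective _ (Ideal.Quotient.mk_surjective (I := z))))
  have hsq₁ : ∀ x, IsSquare (φ₁ x) → IsSquare (φ₂ x) := fun x => by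
    obtain ⟨a, rfl⟩ := Ideal.Quotient.mk_surjective x
    exact hzsq a
  -- One total ordering of a field contained in another equals it.
  have hsq : ∀ x, IsSquare (φ₁ x) ↔ IsSquare (φ₂ x) := fun x => by
    refine ⟨hsq₁ x, fun h => ?_⟩
    rcases IsIVTField.isSquare_or_isSquare_neg (φ₁ x) with h' | h'
    · exact h'
    · rw [← map_neg] at h'
      have h'' := hsq₁ _ h'
      rw [map_neg] at h''
      have hx : x = 0 := φ₂.injective ((IsIVTField.eq_zero h h'').trans (map_zero _).symm)
      simp [hx]
  obtain ⟨ψ, hψ⟩ := IsIVTField.exists_ringHom φ₁ φ₂ hi₁ hi₂ hsq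
  exact ⟨L, inferInstance, inferInstance, π, ψ.comp (Ideal.Quotient.mk z), hπy, fun a =>
    hψ (Ideal.Quotient.mk p a)⟩

open Polynomial in
/-- If `C` and `D` induce the same ordering of `A`, then `D` maps to `C` over `A`. -/
theorem exists_ringHom_over (hA : IsVonNeumannRegular A)
    (hC : IsRealClosedStar C) (hCr : IsVonNeumannRegular C)
    (hD : IsRealClosedStar D) (hDr : IsVonNeumannRegular D) {f : A →+* C} {g : A →+* D}
    (hf : IsEssentialExtension f) (hg : Function.Injective g)
    (hfi : f.IsIntegral) (hgi : g.IsIntegral)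
    (hfg : ∀ a, IsSquare (f a) → IsSquare (g a)) : ∃ ρ : D →+* C, ∀ a, ρ (g a) = f a := by
  choose L hL hIVT π ψ hπ hψ using
    exists_ringHom_residue hA hC hCr hD hDr hf hg hfi hgi hfg
  have := hC.1
  obtain ⟨S, k, r, hS, hk, hr, -⟩ := hC.exists_retraction_pi hCr π (fun c hc => by
    have h2 : c ∈ nilradical C := nilpotent_iff_mem_prime.2 fun J hJ => (hπ ⟨J, hJ⟩ c).1 (hc _)
    rwa [nilradical_eq_zero, Ideal.zero_eq_bot, Ideal.mem_bot] at h2)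
    (fun i c hc => (hC.isSquare_of_nonneg hCr hc).map (π i))
  have hcomp : (RingHom.pi ψ).comp g = (RingHom.pi π).comp f :=
    RingHom.ext fun a => funext fun i => hψ i a
  -- Elements of `D` are integral over `A`, so their images are integral over `C`.
  have hmem : ∀ d, RingHom.pi ψ d ∈ S := fun d => by
    obtain ⟨p, hp, hpd⟩ := hgi d
    refine hS _ ⟨p.map f, hp.map f, ?_⟩
    rw [eval₂_map, ← hcomp, ← hom_eval₂, hpd, map_zero]
  refine ⟨r.comp ((RingHom.pi ψ).codRestrict S hmem), fun a => ?_⟩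
  refine Eq.trans ?_ (hr (f a))
  refine congrArg r (Subtype.ext (funext fun i => ?_))
  rw [hk]
  exact hψ i a

end Compare

theorem IsPositiveCone.exists_ringHom_isRealClosedStar {A : Type u} [CommRing A] [IsReduced A]
    {P : Set A} (hP : IsPositiveCone P) :
    ∃ (C : Type u) (_ : CommRing C) (_ : PartialOrder C) (f : A →+* C),
      IsRealClosedStar C ∧ IsEssentialExtension f ∧ f.IsIntegral ∧ ∀ a ∈ P, 0 ≤ f a := by
  let : PartialOrder A := hP.partialOrder
  have : IsRealPoring A := hP.isRealPoring
  obtain ⟨C, _, _, f, hf⟩ := hasRealClosureStar A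
  exact ⟨C, inferInstance, inferInstance, f, hf.realClosedStar, hf.essential, hf.integral,
    fun a ha => by simpa using f.monotone' (hP.nonneg_iff.2 ha)⟩

/-! ### Isomorphism of real closures `*` and the topological criterion -/

section RealClosure

variable {A C D : Type u} [CommRing A] [PartialOrder A] [CommRing C]
  [PartialOrder C] [CommRing D] [PartialOrder D]

theorem IsRealClosureStar.isVonNeumannRegular (hA : IsVonNeumannRegular A) {f : A →+*o C}
    (hf : IsRealClosureStar f) : IsVonNeumannRegular C := by
  have := hf.realClosedStar.1
  exact hA.of_isIntegral hf.integral

/-- Real closures `*` inducing the same ordering are isomorphic. -/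
theorem isIsomorphicOver_of_isSquare (hA : IsVonNeumannRegular A) {f : A →+*o C} {g : A →+*o D}
    (hf : IsRealClosureStar f) (hg : IsRealClosureStar g)
    (hfg : ∀ a, IsSquare (f a) → IsSquare (g a)) : IsIsomorphicOver f g := by
  have hC := hf.realClosedStar
  have hD := hg.realClosedStar
  have hCr := hf.isVonNeumannRegular hA
  have hDr := hg.isVonNeumannRegular hA
  have := hC.1
  have := hD.1
  obtain ⟨ρ, hρ⟩ := exists_ringHom_over hA hC hCr hD hDr hf.essential hg.essential.1
    hf.integral hg.integral hfg
  have hρg : ρ.comp (g : A →+* D) = (f : A →+* C) := RingHom.ext hρ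
  have hinj : Function.Injective ρ := by
    rw [RingHom.injective_iff_ker_eq_bot]
    by_contra hne
    refine hg.essential.2 _ hne ?_
    rw [RingHom.ker_eq_comap_bot, Ideal.comap_comap, hρg, ← RingHom.ker_eq_comap_bot]
    exact (RingHom.injective_iff_ker_eq_bot _).1 hf.essential.1
  -- Through `ρ`, the ring `C` is an essential integral extension of the real closed `*` ring `D`.
  have hsurj : Function.Surjective ρ := by
    refine hD.2 C (ρ.toOrderRingHom fun d hd => (hC.nonneg_iff_isSquare hCr).2
      ((hD.isSquare_of_nonneg hDr hd).map ρ)) ((isEssentialExtension_iff _).2 ⟨hinj, fun c hc => ?_⟩)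
      (RingHom.IsIntegral.tower_top (g : A →+* D) ρ (hρg ▸ hf.integral))
    obtain ⟨c', a, ha, hca⟩ := ((isEssentialExtension_iff _).1 hf.essential).2 c hc
    refine ⟨c', g a, fun h => ha (hg.essential.1 (h.trans (map_zero g).symm)), ?_⟩
    rw [hca]
    exact (hρ a).symm
  let e : C ≃+* D := (RingEquiv.ofBijective ρ ⟨hinj, hsurj⟩).symm
  refine ⟨{ e with map_le_map_iff' := fun {a b} => ?_ }, fun a => ?_⟩
  · change e a ≤ e b ↔ a ≤ b
    rw [← sub_nonneg, ← sub_nonneg (a := b), ← map_sub, hC.nonneg_iff_isSquare hCr,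
      hD.nonneg_iff_isSquare hDr]
    refine ⟨fun h => ?_, fun h => h.map e⟩
    have := h.map e.symm
    rwa [e.symm_apply_apply] at this
  · change e (f a) = g a
    exact (RingEquiv.ofBijective ρ ⟨hinj, hsurj⟩).symm_apply_eq.2 (hρ a).symm

variable [IsRealPoring A]

/-- If the prime cones with `x > 0` and those with `x < 0` never have supports overlapping in an
open set, then all real closures `*` of `A` induce the same ordering. -/
theorem isSquare_of_forall_interior_eq_empty (hA : IsVonNeumannRegular A)
    {f : A →+*o C} {g : A →+*o D} (hf : IsRealClosureStar f) (hg : IsRealClosureStar g)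
    (hno : ∀ x : A, ¬ (interior (RealSpectrum.supp '' RealSpectrum.P x ∩
          RealSpectrum.supp '' RealSpectrum.P (-x))).Nonempty)
    (a : A) (ha : IsSquare (f a)) : IsSquare (g a) := by
  have hC := hf.realClosedStar
  have hD := hg.realClosedStar
  have hCr := hf.isVonNeumannRegular hA
  have hDr := hg.isVonNeumannRegular hA
  have := hC.1
  have := hD.1
  obtain ⟨n, w, hn, hw, hpos, hneg⟩ := hD.exists_idempotent_neg hDr (g a)
  by_cases hn0 : n = 0
  · rwa [hn0, sub_zero, one_mul] at hpos
  exfalso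
  -- As `g b` is a multiple of `n`, wherever `b` does not vanish `a` is negative through `D`. There
  -- `a` is nonzero, hence positive through `C`.
  obtain ⟨d, b, hb, hdb⟩ := ((isEssentialExtension_iff _).1 hg.essential).2 n hn0
  change d * n = g b at hdb
  refine hno a ?_
  have hsub : (PrimeSpectrum.basicOpen b : Set (PrimeSpectrum A)) ⊆
      RealSpectrum.supp '' RealSpectrum.P a ∩ RealSpectrum.supp '' RealSpectrum.P (-a) := by
    intro p hp
    have hbp : b ∉ p.asIdeal := hp
    have hover : ∀ {E : Type u} [CommRing E] [PartialOrder E] (h : A →+*o E),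
        IsRealClosureStar h → ∃ (L : Type u) (_ : Field L) (_ : IsIVTField L) (π : E →+* L),
          ∀ u, π (h u) = 0 ↔ u ∈ p.asIdeal := by
      intro E _ _ h hh
      obtain ⟨y, hy⟩ := hh.integral.comap_surjective hh.essential.1 p
      obtain ⟨L, _, _, π, -, hπ⟩ := hh.realClosedStar.exists_isIVTField_quotient
        (hh.isVonNeumannRegular hA) y.asIdeal
      refine ⟨L, inferInstance, inferInstance, π, fun u => ?_⟩
      rw [hπ, ← hy]
      rfl
    obtain ⟨L, _, _, π, hπ⟩ := hover f hf
    obtain ⟨L', _, _, π', hπ'⟩ := hover g hg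
    have hnb : π' n ≠ 0 := fun h => hbp ((hπ' b).1 (by rw [← hdb, map_mul, h, mul_zero]))
    have hap : a ∉ p.asIdeal := fun h => hnb (by rw [hw, map_mul, (hπ' a).2 h, mul_zero])
    constructor
    · obtain ⟨α, hα, hαs⟩ := exists_realSpectrum (π.comp (f : A →+* C)) fun u hu =>
        (hC.isSquare_of_nonneg (hf.isVonNeumannRegular hA)
          (by simpa using f.monotone' hu)).map π
      refine ⟨α, ⟨(hα a).2 (ha.map π), fun h => hap ((hπ a).1 ((hαs a).1 h))⟩, ?_⟩
      exact PrimeSpectrum.ext (Ideal.ext fun u => (hαs u).trans (hπ u))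
    · obtain ⟨α, hα, hαs⟩ := exists_realSpectrum (π'.comp (g : A →+* D)) fun u hu =>
        (hD.isSquare_of_nonneg (hg.isVonNeumannRegular hA)
          (by simpa using g.monotone' hu)).map π'
      have h1 : π' n = 1 := by
        have h2 : π' n * π' n = π' n := by rw [← map_mul, hn]
        exact mul_left_cancel₀ hnb (by rw [h2, mul_one])
      have h3 := hneg.map π'
      rw [map_neg, map_mul, h1, one_mul] at h3
      refine ⟨α, ⟨(hα (-a)).2 ?_, fun h => hap ?_⟩, ?_⟩
      · rw [map_neg]
        exact h3
      · have := (hπ' (-a)).1 ((hαs (-a)).1 h)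
        exact neg_mem_iff.1 this
      · exact PrimeSpectrum.ext (Ideal.ext fun u => (hαs u).trans (hπ' u))
  have hopen : (PrimeSpectrum.basicOpen b : Set (PrimeSpectrum A)).Nonempty := by
    by_contra hemp
    rw [Set.not_nonempty_iff_eq_empty] at hemp
    refine hb ?_
    have h2 : b ∈ nilradical A := nilpotent_iff_mem_prime.2 fun J hJ => by
      by_contra hbJ
      have : (⟨J, hJ⟩ : PrimeSpectrum A) ∈ (PrimeSpectrum.basicOpen b : Set _) := hbJ
      rw [hemp] at this
      exact this
    rwa [nilradical_eq_zero, Ideal.zero_eq_bot, Ideal.mem_bot] at h2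
  exact hopen.mono (interior_maximal hsub (PrimeSpectrum.basicOpen b).isOpen)

/-- If `x` is positive for some prime cone over each point of the support of the idempotent `e`,
then `e * x` can be made nonnegative. -/
theorem isPositiveCone_adjoin [IsReduced A] {e x : A} (he : e * e = e)
    (hx : ∀ p : PrimeSpectrum A, e ∉ p.asIdeal → p ∈ RealSpectrum.supp '' RealSpectrum.P x) :
    IsPositiveCone {z : A | ∃ s t : A, 0 ≤ s ∧ 0 ≤ t ∧ z = s + e * x * t} where
  add_mem := by
    rintro _ _ ⟨s, t, hs, ht, rfl⟩ ⟨s', t', hs', ht', rfl⟩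
    exact ⟨s + s', t + t', add_nonneg hs hs', add_nonneg ht ht', by ring⟩
  mul_mem := by
    rintro _ _ ⟨s, t, hs, ht, rfl⟩ ⟨s', t', hs', ht', rfl⟩
    have h := (isPositiveCone_nonneg A).mul_self_mem (e * x)
    exact ⟨s * s' + e * x * (e * x) * (t * t'), s * t' + t * s',
      add_nonneg (mul_nonneg hs hs') (mul_nonneg h (mul_nonneg ht ht')),
      add_nonneg (mul_nonneg hs ht') (mul_nonneg ht hs'), by ring⟩
  mul_self_mem a := ⟨a * a, 0, (isPositiveCone_nonneg A).mul_self_mem a, le_rfl, by ring⟩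
  eq_zero := by
    rintro _ ⟨s, t, hs, ht, rfl⟩ ⟨s', t', hs', ht', h⟩
    have hsum : s + s' + e * x * (t + t') = 0 := by linear_combination -h
    have h1e : 0 ≤ 1 - e := by
      have := (isPositiveCone_nonneg A).mul_self_mem (1 - e)
      have h2 : (1 - e) * (1 - e) = 1 - e := by linear_combination he
      rwa [h2] at this
    -- Off `e` nothing was adjoined, so the original cone decides. At a prime omitting `e`, a prime
    -- cone with `x > 0` decides instead.
    have hes : (1 - e) * s = 0 := by
      refine (isPositiveCone_nonneg A).eq_zero (mul_nonneg h1e hs) ?_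
      have h2 : -((1 - e) * s) = (1 - e) * s' := by
        linear_combination -(1 - e) * hsum - x * (t + t') * he
      rw [h2]
      exact mul_nonneg h1e hs'
    have hall : s + e * x * t ∈ nilradical A := nilpotent_iff_mem_prime.2 fun J hJ => by
      by_cases heJ : e ∈ J
      · have h2 : s + e * x * t = e * (s + x * t) := by linear_combination hes
        rw [h2]
        exact J.mul_mem_right _ heJ
      · obtain ⟨α, ⟨hxα, hxs⟩, hα⟩ := hx ⟨J, hJ⟩ heJ
        have hαJ : α.supp.asIdeal = J := congrArg PrimeSpectrum.asIdeal hα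
        rw [hαJ] at hxs
        have hmem : ∀ u, u ∈ J ↔ u ∈ α.cone ∧ -u ∈ α.cone := fun u => by
          rw [← hαJ]; exact Iff.rfl
        have h1J : 1 - e ∈ J := by
          have h3 : e * (1 - e) ∈ J := by
            have : e * (1 - e) = 0 := by linear_combination -he
            rw [this]; exact J.zero_mem
          exact (hJ.mem_or_mem h3).resolve_left heJ
        have hsα : s + s' ∈ α.cone := α.mem_of_nonneg _ (add_nonneg hs hs')
        have htα : t + t' ∈ α.cone := α.mem_of_nonneg _ (add_nonneg ht ht')
        have hrel : s + s' + x * (t + t') ∈ J := by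
          have h3 : s + s' + x * (t + t') = (1 - e) * (x * (t + t')) := by
            linear_combination hsum
          rw [h3]; exact J.mul_mem_right _ h1J
        -- The support of a prime cone is convex.
        have hle : ∀ {u v}, u ∈ α.cone → v ∈ α.cone → u + v ∈ J → u ∈ J := by
          intro u v hu hv huv
          refine (hmem u).2 ⟨hu, ?_⟩
          have h4 : -u = v + -(u + v) := by ring
          rw [h4]
          exact add_mem hv ((hmem _).1 huv).2
        have hsJ : s + s' ∈ J := hle hsα (mul_mem hxα htα) hrel
        have hxt : x * (t + t') ∈ J := by
          have := J.sub_mem hrel hsJ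
          simpa using this
        have htJ : t + t' ∈ J := (hJ.mem_or_mem hxt).resolve_left hxs
        exact J.add_mem (hle (α.mem_of_nonneg s hs) (α.mem_of_nonneg s' hs') hsJ)
          (J.mul_mem_left _ (hle (α.mem_of_nonneg t ht) (α.mem_of_nonneg t' ht') htJ))
    rwa [nilradical_eq_zero, Ideal.zero_eq_bot, Ideal.mem_bot] at hall

/-- A real closure `*` with prescribed nonnegative elements. -/
theorem IsPositiveCone.exists_isRealClosureStar [IsReduced A] {P : Set A} (hP : IsPositiveCone P)
    (hAP : ∀ a : A, 0 ≤ a → a ∈ P) :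
    ∃ (C : Type u) (_ : CommRing C) (_ : PartialOrder C) (f : A →+*o C),
      IsRealClosureStar f ∧ ∀ a ∈ P, 0 ≤ f a := by
  obtain ⟨C, _, _, f, hC, hess, hintegral, hnn⟩ := hP.exists_ringHom_isRealClosedStar
  have := hC.1
  exact ⟨C, inferInstance, inferInstance, f.toOrderRingHom fun a ha => hnn a (hAP a ha),
    ⟨hC, hess, hintegral⟩, hnn⟩

/-- Over a suitable idempotent, `x` may be declared nonnegative or nonpositive at will. A unique
real closure `*` would satisfy both, forcing `x` to vanish where some prime cone makes it positive.
-/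
theorem not_hasUniqueRealClosureStar (hA : IsVonNeumannRegular A) {x : A}
    (hx : (interior (RealSpectrum.supp '' RealSpectrum.P x ∩
      RealSpectrum.supp '' RealSpectrum.P (-x))).Nonempty) : ¬ HasUniqueRealClosureStar A := by
  rintro ⟨E, _, _, h, hh, huniq⟩
  obtain ⟨q, hq⟩ := hx
  obtain ⟨_, ⟨b, rfl⟩, hqb, hb⟩ :=
    PrimeSpectrum.isTopologicalBasis_basic_opens.exists_subset_of_mem_open hq isOpen_interior
  replace hb := hb.trans interior_subset
  -- The idempotent `b * b'` defines the same basic open set as `b`.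
  obtain ⟨b', he, heb⟩ := hA.exists_idempotent b
  have hsub : ∀ p : PrimeSpectrum A, b * b' ∉ p.asIdeal →
      p ∈ RealSpectrum.supp '' RealSpectrum.P x ∩ RealSpectrum.supp '' RealSpectrum.P (-x) :=
    fun p hp => hb (fun hbp => hp (p.asIdeal.mul_mem_right _ hbp))
  have hred := hA.isReduced
  obtain ⟨C, _, _, f, hf, hfx⟩ := (isPositiveCone_adjoin he fun p hp =>
    (hsub p hp).1).exists_isRealClosureStar fun a ha => ⟨a, 0, ha, le_rfl, by ring⟩
  obtain ⟨D, _, _, g, hg, hgx⟩ := (isPositiveCone_adjoin he fun p hp =>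
    (hsub p hp).2).exists_isRealClosureStar fun a ha => ⟨a, 0, ha, le_rfl, by ring⟩
  obtain ⟨e₁, he₁⟩ := huniq C f hf
  obtain ⟨e₂, he₂⟩ := huniq D g hg
  have := hh.realClosedStar.1
  have := hf.realClosedStar.1
  have := hg.realClosedStar.1
  have h1 : 0 ≤ h (b * b' * x) := by
    rw [← map_le_map_iff e₁, map_zero, he₁]
    exact hfx _ ⟨0, 1, le_rfl, zero_le_one, by ring⟩
  have h2 : 0 ≤ h (-(b * b' * x)) := by
    rw [← map_le_map_iff e₂, map_zero, he₂]
    exact hgx _ ⟨0, 1, le_rfl, zero_le_one, by ring⟩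
  rw [map_neg, neg_nonneg] at h2
  have h3 : b * b' * x = 0 := hh.essential.1 ((le_antisymm h2 h1).trans (map_zero h).symm)
  obtain ⟨⟨α, ⟨-, hα⟩, rfl⟩, -⟩ := hb hqb
  have h4 : b * b' * x ∈ α.supp.asIdeal := h3 ▸ α.supp.asIdeal.zero_mem
  rcases α.supp.isPrime.mem_or_mem h4 with h5 | h5
  · refine hqb ?_
    rw [← heb]
    exact α.supp.asIdeal.mul_mem_right _ h5
  · exact hα h5

end RealClosure

theorem mainTheorem2 {A : Type u} [CommRing A] [PartialOrder A] [IsRealPoring A]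
    (hA : IsVonNeumannRegular A) :
    HasRealClosureStar A ∧
      (¬ HasUniqueRealClosureStar A ↔
        ∃ x : A, (interior (RealSpectrum.supp '' RealSpectrum.P x ∩
          RealSpectrum.supp '' RealSpectrum.P (-x))).Nonempty) := by
  refine ⟨hasRealClosureStar A, fun hnu => ?_, fun ⟨x, hx⟩ => not_hasUniqueRealClosureStar hA hx⟩
  by_contra hno
  push Not at hno
  obtain ⟨C, _, _, f, hf⟩ := hasRealClosureStar A
  exact hnu ⟨C, inferInstance, inferInstance, f, hf, fun D _ _ g hg =>
    isIsomorphicOver_of_isSquare hA hf hg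
      (isSquare_of_forall_interior_eq_empty hA hf hg fun x => by simp [hno x])⟩
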